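/- Let $(E,\mathcal E,\mu)$ be a complete probability space, $(\Omega,\mathcal F,\mathbb P)$ a probability space, and $\mathcal H$ a separable real Hilbert space with its Borel $\sigma$-algebra. Let $A:E\times\mathcal H\to 2^{\mathcal H}$ be such that (a) for $\mu$-almost every $s$, the operator $A(s,\cdot)$ is maximal monotone; and (b) for all $\lambda>0$ and $x\in\mathcal H$, the resolvent $s\mapsto J_\lambda(s,x)=(I+\lambda A(s,\cdot))^{-1}(x)$ is measurable (for $\mu$-a.e. $s$ it is single-valued by (a)). Write $A_\lambda(s,x)=(x-J_\lambda(s,x))/\lambda$ for the Yosida approximation. Let $(\lambda_n)_{n\ge 0}$ be positive reals with $\sum_n\lambda_n^2<\infty$ and $\sum_n\lambda_n=\infty$, let $(\xi_n)_{n\ge1}$ be independent random variables $\Omega\to E$ with common law $\mu$, let $x_0\in\mathcal H$ be fixed, and set $$x_{n+1}=J_{\lambda_n}(\xi_{n+1},x_n)\quad(n\ge 0),\qquad \overline x_n=\frac{\sum_{k=1}^n\lambda_kx_k}{\sum_{k=1}^n\lambda_k}\quad(n\ge 1).$$ For $p\ge1$, let $S^p_A(x)$ be the set of measurable $\phi:E\to\mathcal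 H$ with $\phi(s)\in A(s,x)$ for $\mu$-a.e. $s$ and $\int\|\phi\|^p\,d\mu<\infty$. Define the mean operator, its zeroes, and $\mathcal Z_A(p)$ by $$\underline A(x)=\Big\{\int\phi\,d\mu:\phi\in S^1_A(x)\Big\},\quad \mathrm{zer}(\underline A)=\{x:0\in\underline A(x)\},\quad \mathcal Z_A(p)=\Big\{x:\exists\,\phi\in S^p_A(x),\ \int\phi\,d\mu=0\Big\}.$$ A sequence $(u_n)_{n\ge1}$ in $\mathcal H$ has property $\overline{UI}$ if the functions $$f_n=\frac{\sum_{k=1}^n\lambda_k\|A_{\lambda_k}(\cdot,u_k)\|}{\sum_{k=1}^n\lambda_k}\quad(n\ge1)$$ are uniformly integrable, i.e. $\lim_{a\to+\infty}\sup_{n\ge1}\int_{\{f_n>a\}}f_n\,d\mu=0$. Assume that $\underline A$ is maximal monotone, that $\mathrm{zer}(\underline A)\ne\emptyset$, and that $\mathrm{zer}(\underline A)\subset\mathcal Z_A(2)$. Let $G\in\mathcal F$ be an event such that for almost every $\omega\in G$ the sequence $(x_n(\omega))$ has property $\overline{UI}$. Then, for almost every $\omega\in G$, $(\overline x_n(\omega))$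 converges weakly to a point of $\mathrm{zer}(\underline A)$ (which may depend on $\omega$). -/

import Mathlib

open MeasureTheory ProbabilityTheory Filter Topology
open scoped ENNReal

noncomputable section

namespace StochProx

variable {H : Type*} [NormedAddCommGroup H] [InnerProductSpace ℝ H]
variable {E : Type*} {Ω : Type*}

/-- A set-valued operator `T : H → 2^H` is monotone. -/
def IsMonotoneOp (T : H → Set H) : Prop :=
  ∀ x x' : H, ∀ y ∈ T x, ∀ y' ∈ T x', 0 ≤ inner ℝ (y - y') (x - x')

/-- A monotone operator is maximal if no other monotone operator has a graph containing its
graph. -/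
def IsMaximalMonotoneOp (T : H → Set H) : Prop :=
  IsMonotoneOp T ∧ ∀ T' : H → Set H, IsMonotoneOp T' → (∀ x, T x ⊆ T' x) → T = T'

/-- The set-valued resolvent `(I + lam T)⁻¹ (x)`, that is, the set of `y` such that
`(x - y) / lam ∈ T y`. -/
def resolventSet (T : H → Set H) (lam : ℝ) (x : H) : Set H :=
  {y | lam⁻¹ • (x - y) ∈ T y}

/-- The resolvent of a monotone operator has at most one value at each point. -/
theorem resolventSet_subsingleton {T : H → Set H} (hT : IsMonotoneOp T) {lam : ℝ}
    (hlam : 0 < lam) (x : H) : (resolventSet T lam x).Subsingleton := by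
  intro y hy z hz
  have h := hT y z _ hy _ hz
  have e : lam⁻¹ • (x - y) - lam⁻¹ • (x - z) = (-lam⁻¹) • (y - z) := by
    rw [← smul_sub, neg_smul, ← smul_neg]; congr 1; abel
  rw [e, real_inner_smul_left, real_inner_self_eq_norm_sq] at h
  have h2 : 0 < lam⁻¹ := inv_pos.mpr hlam
  have h3 : ‖y - z‖ ^ 2 ≤ 0 := by nlinarith [sq_nonneg ‖y - z‖]
  have h4 : ‖y - z‖ = 0 := by nlinarith [norm_nonneg (y - z)]
  exact sub_eq_zero.mp (norm_eq_zero.mp h4)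

/-- The resolvent as a single-valued map: the element of `resolventSet T lam x`. For `T` maximal
monotone and `0 < lam` this set is a singleton (Minty). When the set is empty the value is an
irrelevant default. -/
def resolventMap (T : H → Set H) (lam : ℝ) (x : H) : H :=
  Classical.epsilon fun y => y ∈ resolventSet T lam x

/-- The Yosida approximation `T_lam (x) = (x - J_lam (x)) / lam`. -/
def yosida (T : H → Set H) (lam : ℝ) (x : H) : H :=
  lam⁻¹ • (x - resolventMap T lam x)

/-- The weighted averages `(∑_{k=1}^n lam_k a_k) / (∑_{k=1}^n lam_k)`. -/
def weightedAvg {V : Type*} [AddCommGroup V] [Module ℝ V] (lam : ℕ → ℝ) (a : ℕ → V) (n : ℕ) : V :=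
  (∑ k ∈ Finset.Icc 1 n, lam k)⁻¹ • ∑ k ∈ Finset.Icc 1 n, lam k • a k

/-- The stochastic proximal point iterates: `x_0` is given and
`x_{n+1} = J_{lam_n} (ξ_{n+1}, x_n)`. -/
def iterates (A : E → H → Set H) (lam : ℕ → ℝ) (ξ : ℕ → Ω → E) (x₀ : H) : ℕ → Ω → H
  | 0, _ => x₀
  | n + 1, ω => resolventMap (A (ξ (n + 1) ω)) (lam n) (iterates A lam ξ x₀ n ω)

variable [MeasurableSpace E]

/-- The `p`-integrable measurable selections of a multifunction `Γ : E → 2^H`. -/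
def selections [MeasurableSpace H] (μ : Measure E) (p : ℝ≥0∞) (Γ : E → Set H) : Set (E → H) :=
  {φ | Measurable φ ∧ (∀ᵐ s ∂μ, φ s ∈ Γ s) ∧ MemLp φ p μ}

/-- The Aumann integral of a multifunction. -/
def aumannIntegral [MeasurableSpace H] (μ : Measure E) (Γ : E → Set H) : Set H :=
  {v | ∃ φ ∈ selections μ 1 Γ, ∫ s, φ s ∂μ = v}

/-- The mean operator `x ↦ ∫ A(s, x) dμ(s)` (Aumann integral). -/
def meanOp [MeasurableSpace H] (μ : Measure E) (A : E → H → Set H) (x : H) : Set H :=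
  aumannIntegral μ fun s => A s x

/-- The zeroes of a set-valued operator. -/
def zer (T : H → Set H) : Set H := {x | 0 ∈ T x}

/-- The set `Z_A(p)` of the points `x` such that `A(·, x)` has a `p`-integrable measurable
selection with integral zero. -/
def zerSel [MeasurableSpace H] (μ : Measure E) (A : E → H → Set H) (p : ℝ≥0∞) : Set H :=
  {x | ∃ φ ∈ selections μ p (fun s => A s x), ∫ s, φ s ∂μ = 0}

/-- Uniform integrability of a family of nonnegative functions:
`sup_i ∫_{f_i > a} f_i dμ → 0` as `a → +∞`. -/
def UnifIntegrableFamily {ι : Type*} (μ : Measure E) (f : ι → E → ℝ) : Prop :=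
  Tendsto (fun a : ℝ => ⨆ i, ∫⁻ s in {s | a < f i s}, ENNReal.ofReal (f i s) ∂μ) atTop (𝓝 0)

/-- The property `UI-bar` of a sequence `u` in `H` (only the terms `u 1, u 2, …` matter): the
weighted averages of the functions `‖A_{lam_k}(·, u_k)‖` are uniformly integrable. -/
def PropertyUIBar (μ : Measure E) (A : E → H → Set H) (lam : ℕ → ℝ) (u : ℕ → H) : Prop :=
  UnifIntegrableFamily μ fun (n : ℕ+) (s : E) =>
    weightedAvg lam (fun k => ‖yosida (A s) (lam k) (u k)‖) n

end StochProx

end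

open StochProx

/-! Let u be a zero of the mean operator, with a square-integrable selection φ of integral zero.
Monotonicity turns one proximal step into ‖x_{n+1} - u‖² + λ_n²‖A_{λ_n}‖²/2 ≤ ‖x_n - u‖² -
2λ_n⟨φ(ξ_{n+1}), x_n - u⟩ + 2λ_n²‖φ(ξ_{n+1})‖². The middle term is centred given the past.
Expectations therefore bound E‖x_n - u‖² and Σ λ_n² E‖A_{λ_n}‖² (`exists_energy_bound`), and L²
martingale convergence makes ‖x_n - u‖² converge along almost every path (`ae_tendsto_norm_sq`). By
an Opial lemma for averages (`exists_tendsto_weightedAvg`) it remains to show that weak cluster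
points of the averages are zeroes.

Take (u, v) in the graph of the mean operator, v = ∫ φ with φ merely integrable. The noise built
from φ may now lack second moments, so the Yosida approximations are used instead. The sums of
λ_k⟨A_{λ_k}(ξ_{k+1}, x_k), x_k - u⟩ telescope and stay bounded; replacing the sampled operator by
its μ-mean costs a convergent martingale (`ae_exists_abs_sum_le`). After division by Σ λ_k these
mean terms vanish. Monotonicity compares them with ⟨v, x_k - u⟩ up to an error λ_k‖φ‖‖A_{λ_k}‖,
negligible where ‖φ‖ ≤ c. On the small set ‖φ‖ > c the boundedness of the path and property UI-bar
take over (`eventually_inner_weightedAvg_le`). Hence every cluster point z satisfies ⟨v, z - u⟩ ≤ 0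
on the whole graph, and maximality puts 0 in the mean operator at z.

Countable dense subsets of the zero set and of the graph reduce the exceptional events to one null
set. Existence of resolvents is Minty's theorem, obtained by minimising the Fitzpatrick function
plus half the squared norm. -/

namespace StochProx

/-! ### Maximal monotone operators and Minty's theorem. -/

section Minty

variable {H : Type*} [NormedAddCommGroup H] [InnerProductSpace ℝ H]

/-- A point monotonically related to the graph of a maximal monotone operator lies in it. -/
theorem IsMaximalMonotoneOp.mem_of_forall {T : H → Set H} (hT : IsMaximalMonotoneOp T) {x y : H}
    (h : ∀ a, ∀ b ∈ T a, 0 ≤ inner ℝ (y - b) (x - a)) : y ∈ T x := by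
  classical
  have key := hT.2 (fun z => T z ∪ {w | z = x ∧ w = y}) ?_ (fun z => Set.subset_union_left)
  · rw [key]
    exact Or.inr ⟨rfl, rfl⟩
  · rintro z z' w (hw | ⟨rfl, rfl⟩) w' (hw' | ⟨rfl, rfl⟩)
    · exact hT.1 z z' w hw w' hw'
    · have := h z w hw
      rwa [← neg_sub w, ← neg_sub z, inner_neg_neg] at this
    · exact h z' w' hw'
    · simp

theorem IsMaximalMonotoneOp.exists_mem {T : H → Set H} (hT : IsMaximalMonotoneOp T) :
    ∃ a, ∃ b, b ∈ T a := by
  by_contra hne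
  push Not at hne
  exact hne 0 0 (hT.mem_of_forall fun a b hb => absurd hb (hne a b))

theorem isMaximalMonotoneOp_of_forall {T : H → Set H} (hT : IsMonotoneOp T)
    (h : ∀ x y, (∀ a, ∀ b ∈ T a, 0 ≤ inner ℝ (y - b) (x - a)) → y ∈ T x) :
    IsMaximalMonotoneOp T :=
  ⟨hT, fun _ hT' hle => funext fun x => Set.Subset.antisymm (hle x) fun y hy =>
    h x y fun a b hb => hT' x a y hy b (hle a hb)⟩

/-- Minimising sequences of a midpoint strongly convex function are Cauchy. -/
theorem cauchySeq_of_midpoint_convex {X : Type*} [PseudoMetricSpace X] {q : ℕ → ℝ} {x : ℕ → X}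
    {m : ℝ} (hq : ∀ n, q n ≤ m + 1 / ((n : ℝ) + 1))
    (hx : ∀ i j, m ≤ (q i + q j) / 2 - dist (x i) (x j) ^ 2 / 8) : CauchySeq x := by
  refine Metric.cauchySeq_iff'.2 fun ε hε => ?_
  obtain ⟨N, hN⟩ := exists_nat_one_div_lt (show 0 < ε ^ 2 / 8 by positivity)
  refine ⟨N, fun n hn => ?_⟩
  have h1 : 1 / ((n : ℝ) + 1) ≤ 1 / ((N : ℝ) + 1) := by gcongr
  have := hx n N
  have h2 : dist (x n) (x N) ^ 2 < ε ^ 2 := by linarith [hq n, hq N]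
  exact lt_of_pow_lt_pow_left₀ 2 hε.le h2

/-- **Minty's theorem**: `I + T` is onto, stated at the origin. -/
theorem IsMaximalMonotoneOp.exists_neg_mem [CompleteSpace H] {T : H → Set H}
    (hT : IsMaximalMonotoneOp T) : ∃ x, -x ∈ T x := by
  -- `C x y r`: `r` bounds the Fitzpatrick function of `T` at `(x, y)`.
  let C : H → H → ℝ → Prop := fun x y r =>
    ∀ a, ∀ b ∈ T a, inner ℝ x b + inner ℝ a y - inner ℝ a b ≤ r
  -- Fitzpatrick's inequality: if r < ⟨x, y⟩, then (x, y) is monotonically related to the graph,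
  -- hence lies in it, and testing the bound at (x, y) itself is contradictory.
  have hCge : ∀ x y r, C x y r → inner ℝ x y ≤ r := by
    intro x y r hC
    by_contra! hlt
    have hmem : y ∈ T x := by
      refine hT.mem_of_forall fun a b hb => ?_
      have h1 := hC a b hb
      rw [inner_sub_left, inner_sub_right, inner_sub_right, real_inner_comm x y,
        real_inner_comm a y, real_inner_comm x b, real_inner_comm a b]
      linarith
    have := hC x y hmem
    linarith
  let Q : H → H → ℝ → ℝ := fun x y r => r + ‖x‖ ^ 2 / 2 + ‖y‖ ^ 2 / 2
  let S : Set ℝ := {t | ∃ x y r, C x y r ∧ Q x y r = t}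
  have hSne : S.Nonempty := by
    obtain ⟨a, b, hb⟩ := hT.exists_mem
    refine ⟨_, a, b, inner ℝ a b, fun a' b' hb' => ?_, rfl⟩
    have := hT.1 a a' b hb b' hb'
    rw [inner_sub_left, inner_sub_right, inner_sub_right, real_inner_comm a b,
      real_inner_comm a' b, real_inner_comm a b', real_inner_comm a' b'] at this
    linarith
  have hQ0 : ∀ x y r, C x y r → ‖x + y‖ ^ 2 / 2 ≤ Q x y r := by
    intro x y r hC
    have h1 := hCge x y r hC
    have h2 := norm_add_sq_real x y
    simp only [Q]; linarith
  have hSbdd : BddBelow S := by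
    refine ⟨0, ?_⟩
    rintro t ⟨x, y, r, hC, rfl⟩
    exact le_trans (by positivity) (hQ0 x y r hC)
  set m := sInf S with hm
  have hmle : ∀ x y r, C x y r → m ≤ Q x y r := fun x y r hC => csInf_le hSbdd ⟨x, y, r, hC, rfl⟩
  have hseq : ∀ n : ℕ, ∃ x y r, C x y r ∧ Q x y r ≤ m + 1 / ((n : ℝ) + 1) := by
    intro n
    have : sInf S < m + 1 / ((n : ℝ) + 1) := by
      have : 0 < 1 / ((n : ℝ) + 1) := by positivity
      linarith
    obtain ⟨t, ⟨x, y, r, hC, rfl⟩, ht⟩ := exists_lt_of_csInf_lt hSne this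
    exact ⟨x, y, r, hC, ht.le⟩
  choose x y r hC hQ using hseq
  have hmid : ∀ i j, m ≤ (Q (x i) (y i) (r i) + Q (x j) (y j) (r j)) / 2
      - dist (x i) (x j) ^ 2 / 8 - dist (y i) (y j) ^ 2 / 8 := by
    intro i j
    have h := hmle ((1 / 2 : ℝ) • (x i + x j)) ((1 / 2 : ℝ) • (y i + y j)) ((r i + r j) / 2) (by
      intro a b hb
      have h1 := hC i a b hb
      have h2 := hC j a b hb
      rw [real_inner_smul_left, real_inner_smul_right, inner_add_left, inner_add_right]
      linarith)
    have e : ∀ p q : H, ‖(1 / 2 : ℝ) • (p + q)‖ ^ 2 =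
        (‖p‖ ^ 2 + ‖q‖ ^ 2) / 2 - ‖p - q‖ ^ 2 / 4 := by
      intro p q
      rw [norm_smul, mul_pow]
      have := parallelogram_law_with_norm ℝ p q
      norm_num
      nlinarith
    simp only [Q, e] at h
    simp only [Q, dist_eq_norm]
    linarith
  obtain ⟨x₀, hx₀⟩ := cauchySeq_tendsto_of_complete (cauchySeq_of_midpoint_convex (x := x) hQ
    fun i j => by have := hmid i j; have := sq_nonneg (dist (y i) (y j)); linarith)
  obtain ⟨y₀, hy₀⟩ := cauchySeq_tendsto_of_complete (cauchySeq_of_midpoint_convex (x := y) hQ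
    fun i j => by have := hmid i j; have := sq_nonneg (dist (x i) (x j)); linarith)
  -- Chosen so that `Q x₀ y₀ r₀ = m`: the infimum is attained at the limit point.
  set r₀ := m - ‖x₀‖ ^ 2 / 2 - ‖y₀‖ ^ 2 / 2 with hr₀
  have hC₀ : C x₀ y₀ r₀ := by
    intro a b hb
    have hL : Tendsto (fun n => inner ℝ (x n) b + inner ℝ a (y n) - inner ℝ a b) atTop
        (𝓝 (inner ℝ x₀ b + inner ℝ a y₀ - inner ℝ a b)) :=
      ((hx₀.inner tendsto_const_nhds).add (tendsto_const_nhds.inner hy₀)).sub_const _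
    have hR : Tendsto (fun n : ℕ => m + 1 / ((n : ℝ) + 1) - ‖x n‖ ^ 2 / 2 - ‖y n‖ ^ 2 / 2) atTop
        (𝓝 (m + 0 - ‖x₀‖ ^ 2 / 2 - ‖y₀‖ ^ 2 / 2)) :=
      ((tendsto_const_nhds.add tendsto_one_div_add_atTop_nhds_zero_nat).sub
        ((hx₀.norm.pow 2).div_const 2)).sub ((hy₀.norm.pow 2).div_const 2)
    rw [add_zero] at hR
    refine le_of_tendsto_of_tendsto' hL hR fun n => ?_
    have h1 := hC n a b hb
    have h2 := hQ n
    simp only [Q] at h2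
    linarith
  -- First-order optimality towards a graph point (a, b), where ⟨a, b⟩ is an admissible bound by
  -- monotonicity; `hCge` then removes r₀.
  have hopt : ∀ a, ∀ b ∈ T a, ‖x₀ + y₀‖ ^ 2 ≤ inner ℝ (a + y₀) (b + x₀) := by
    intro a b hb
    -- moving from `(x₀, y₀)` towards `(a, b)` does not decrease `Q`
    have hdir : ∀ t : ℝ, 0 < t → t ≤ 1 → 0 ≤ (inner ℝ a b - r₀ + inner ℝ x₀ (a - x₀)
        + inner ℝ y₀ (b - y₀)) + t * ((‖a - x₀‖ ^ 2 + ‖b - y₀‖ ^ 2) / 2) := by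
      intro t ht0 ht1
      have h := hmle (x₀ + t • (a - x₀)) (y₀ + t • (b - y₀)) ((1 - t) * r₀ + t * inner ℝ a b) (by
        intro a' b' hb'
        have h1 := hC₀ a' b' hb'
        have h2 := hT.1 a a' b hb b' hb'
        rw [inner_sub_left, inner_sub_right, inner_sub_right, real_inner_comm a b,
          real_inner_comm a' b, real_inner_comm a b', real_inner_comm a' b'] at h2
        rw [inner_add_left, inner_add_right, real_inner_smul_left, real_inner_smul_right,
          inner_sub_left, inner_sub_right]
        nlinarith [mul_le_mul_of_nonneg_left h1 (sub_nonneg.2 ht1), mul_nonneg ht0.le h2])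
      simp only [Q] at h
      rw [norm_add_sq_real, norm_add_sq_real, norm_smul, norm_smul, real_inner_smul_right,
        real_inner_smul_right, mul_pow, mul_pow, Real.norm_eq_abs, sq_abs] at h
      have h3 : 0 ≤ t * ((inner ℝ a b - r₀ + inner ℝ x₀ (a - x₀)
        + inner ℝ y₀ (b - y₀)) + t * ((‖a - x₀‖ ^ 2 + ‖b - y₀‖ ^ 2) / 2)) := by
        nlinarith
      exact nonneg_of_mul_nonneg_right h3 ht0
    have hlim : 0 ≤ inner ℝ a b - r₀ + inner ℝ x₀ (a - x₀) + inner ℝ y₀ (b - y₀) := by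
      refine le_of_forall_pos_le_add fun ε hε => ?_
      set K := (‖a - x₀‖ ^ 2 + ‖b - y₀‖ ^ 2) / 2 with hK
      have hK0 : 0 ≤ K := by positivity
      have ht : 0 < min 1 (ε / (K + 1)) := lt_min one_pos (by positivity)
      refine (hdir _ ht (min_le_left _ _)).trans ?_
      gcongr
      calc min 1 (ε / (K + 1)) * K ≤ ε / (K + 1) * (K + 1) := by
            gcongr
            · exact min_le_right _ _
            · linarith
        _ = ε := by field_simp
    have hge := hCge x₀ y₀ r₀ hC₀
    rw [inner_sub_right, inner_sub_right, real_inner_self_eq_norm_sq,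
      real_inner_self_eq_norm_sq] at hlim
    rw [norm_add_sq_real, inner_add_left, inner_add_right, inner_add_right, real_inner_comm x₀ a,
      real_inner_comm x₀ y₀]
    have e := real_inner_comm x₀ y₀
    linarith [e]
  have hmem : -x₀ ∈ T (-y₀) := by
    refine hT.mem_of_forall fun a b hb => ?_
    have := hopt a b hb
    have e : inner ℝ (-x₀ - b) (-y₀ - a) = inner ℝ (a + y₀) (b + x₀) := by
      rw [← neg_add', ← neg_add', inner_neg_neg, real_inner_comm, add_comm a, add_comm b]
    rw [e]
    exact le_trans (by positivity) this
  -- At the graph point (-y₀, -x₀) the right-hand side vanishes, which forces x₀ + y₀ = 0.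
  have h0 := hopt _ _ hmem
  simp only [neg_add_cancel, inner_zero_left] at h0
  have h1 : x₀ + y₀ = 0 := by
    have : ‖x₀ + y₀‖ = 0 := by
      nlinarith [norm_nonneg (x₀ + y₀)]
    exact norm_eq_zero.1 this
  refine ⟨x₀, ?_⟩
  rwa [← eq_neg_of_add_eq_zero_left h1] at hmem

theorem resolventMap_eq_sub {T : H → Set H} {l : ℝ} (hl : 0 < l) (x : H) :
    resolventMap T l x = x - l • yosida T l x := by
  simp [yosida, smul_smul, hl.ne']

theorem norm_sq_resolventMap_sub {T : H → Set H} {l : ℝ} (hl : 0 < l) (x u : H) :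
    ‖resolventMap T l x - u‖ ^ 2 =
      ‖x - u‖ ^ 2 - 2 * (l * inner ℝ (yosida T l x) (x - u)) + l ^ 2 * ‖yosida T l x‖ ^ 2 := by
  have e : resolventMap T l x - u = (x - u) - l • yosida T l x := by
    rw [resolventMap_eq_sub hl]; abel
  rw [e, norm_sub_sq_real, norm_smul, mul_pow, Real.norm_of_nonneg hl.le, real_inner_smul_right,
    real_inner_comm (x - u)]

/-- The zero operator is maximal monotone. -/
theorem isMaximalMonotoneOp_zero : IsMaximalMonotoneOp fun _ : H => ({0} : Set H) := by
  refine isMaximalMonotoneOp_of_forall ?_ ?_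
  · rintro x x' y rfl y' rfl; simp
  · intro x y h
    have h1 := h (x + y) 0 rfl
    simp only [sub_zero, sub_add_cancel_left, inner_neg_right, real_inner_self_eq_norm_sq] at h1
    have : ‖y‖ = 0 := by nlinarith [norm_nonneg y]
    exact norm_eq_zero.1 this

end Minty

/-! ### Resolvents and Yosida approximations. -/

section Resolvent

variable {H : Type*} [NormedAddCommGroup H] [InnerProductSpace ℝ H] [CompleteSpace H]

/-- Minty's theorem at the origin, applied to the translated and rescaled operator z ↦ l T(z + x),
which is again maximal monotone. -/
theorem IsMaximalMonotoneOp.resolventSet_nonempty {T : H → Set H} (hT : IsMaximalMonotoneOp T)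
    {l : ℝ} (hl : 0 < l) (x : H) : (resolventSet T l x).Nonempty := by
  have hT' : IsMaximalMonotoneOp fun z => {w | l⁻¹ • w ∈ T (z + x)} := by
    refine isMaximalMonotoneOp_of_forall ?_ ?_
    · intro z z' w hw w' hw'
      have h := hT.1 _ _ _ hw _ hw'
      rw [← smul_sub, add_sub_add_right_eq_sub, real_inner_smul_left] at h
      exact nonneg_of_mul_nonneg_right h (inv_pos.2 hl)
    · intro z w h
      refine hT.mem_of_forall fun a b hb => ?_
      have h1 := h (a - x) (l • b) (by simpa [smul_smul, hl.ne'] using hb)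
      have e : l⁻¹ • w - b = l⁻¹ • (w - l • b) := by
        rw [smul_sub, smul_smul, inv_mul_cancel₀ hl.ne', one_smul]
      have e' : z + x - a = z - (a - x) := by abel
      rw [e, e', real_inner_smul_left]
      exact mul_nonneg (inv_pos.2 hl).le h1
  obtain ⟨z, hz⟩ := hT'.exists_neg_mem
  refine ⟨z + x, ?_⟩
  simpa [resolventSet] using hz

theorem IsMaximalMonotoneOp.yosida_mem {T : H → Set H} (hT : IsMaximalMonotoneOp T)
    {l : ℝ} (hl : 0 < l) (x : H) : yosida T l x ∈ T (resolventMap T l x) :=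
  Classical.epsilon_spec (hT.resolventSet_nonempty hl x)

/-- Monotonicity at the two resolvent points p, q gives ‖p - q‖² ≤ ⟨x - y, p - q⟩; Cauchy–Schwarz
concludes. -/
theorem IsMaximalMonotoneOp.norm_resolventMap_sub_le {T : H → Set H} (hT : IsMaximalMonotoneOp T)
    {l : ℝ} (hl : 0 < l) (x y : H) :
    ‖resolventMap T l x - resolventMap T l y‖ ≤ ‖x - y‖ := by
  have h := hT.1 _ _ _ (hT.yosida_mem hl x) _ (hT.yosida_mem hl y)
  set p := resolventMap T l x with hp
  set q := resolventMap T l y with hq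
  have e : yosida T l x - yosida T l y = l⁻¹ • ((x - y) - (p - q)) := by
    simp only [yosida, ← smul_sub, ← hp, ← hq]; congr 1; abel
  rw [e, real_inner_smul_left] at h
  have h1 := nonneg_of_mul_nonneg_right h (inv_pos.2 hl)
  rw [inner_sub_left, real_inner_self_eq_norm_sq] at h1
  have h2 := real_inner_le_norm (x - y) (p - q)
  by_contra! hlt
  nlinarith [norm_nonneg (x - y), norm_nonneg (p - q)]

/-- Since u minus its resolvent is l times the Yosida value g, monotonicity reads ‖g‖² ≤ ⟨φ, g⟩. -/
theorem IsMaximalMonotoneOp.norm_yosida_le {T : H → Set H} (hT : IsMaximalMonotoneOp T)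
    {l : ℝ} (hl : 0 < l) {u φ : H} (hφ : φ ∈ T u) : ‖yosida T l u‖ ≤ ‖φ‖ := by
  have h := hT.1 _ _ _ hφ _ (hT.yosida_mem hl u)
  rw [resolventMap_eq_sub hl, sub_sub_cancel, real_inner_smul_right] at h
  have h1 := nonneg_of_mul_nonneg_right h hl
  rw [inner_sub_left, real_inner_self_eq_norm_sq] at h1
  have h2 := real_inner_le_norm φ (yosida T l u)
  by_contra! hlt
  nlinarith [norm_nonneg φ, norm_nonneg (yosida T l u)]

theorem IsMaximalMonotoneOp.continuous_resolventMap {T : H → Set H} (hT : IsMaximalMonotoneOp T)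
    {l : ℝ} (hl : 0 < l) : Continuous (resolventMap T l) :=
  (LipschitzWith.of_dist_le_mul (K := 1) fun x y => by
    simpa [dist_eq_norm] using hT.norm_resolventMap_sub_le hl x y).continuous

/-- Resolvents displace `u` by at most `l‖φ‖` when `φ ∈ T u`. -/
theorem IsMaximalMonotoneOp.norm_resolventMap_sub_le_add {T : H → Set H}
    (hT : IsMaximalMonotoneOp T) {l : ℝ} (hl : 0 < l) {u φ : H} (hφ : φ ∈ T u) (x : H) :
    ‖resolventMap T l x - u‖ ≤ ‖x - u‖ + l * ‖φ‖ := by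
  have h1 := hT.norm_resolventMap_sub_le hl x u
  have h2 : ‖resolventMap T l u - u‖ ≤ l * ‖φ‖ := by
    rw [resolventMap_eq_sub hl, sub_sub_cancel_left, norm_neg, norm_smul, Real.norm_of_nonneg hl.le]
    gcongr
    exact hT.norm_yosida_le hl hφ
  calc _ = ‖(resolventMap T l x - resolventMap T l u) + (resolventMap T l u - u)‖ := by
        congr 1; abel
    _ ≤ _ := (norm_add_le _ _).trans (add_le_add h1 h2)

theorem IsMaximalMonotoneOp.norm_yosida_le_add {T : H → Set H}
    (hT : IsMaximalMonotoneOp T) {l : ℝ} (hl : 0 < l) {u φ : H} (hφ : φ ∈ T u) (x : H) :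
    ‖yosida T l x‖ ≤ l⁻¹ * (2 * ‖x - u‖) + ‖φ‖ := by
  have h1 := hT.norm_resolventMap_sub_le_add hl hφ x
  rw [yosida, norm_smul, norm_inv, Real.norm_of_nonneg hl.le]
  have h2 : ‖x - resolventMap T l x‖ ≤ 2 * ‖x - u‖ + l * ‖φ‖ := by
    calc _ = ‖(x - u) - (resolventMap T l x - u)‖ := by congr 1; abel
      _ ≤ _ := norm_sub_le _ _
      _ ≤ _ := by linarith
  calc _ ≤ l⁻¹ * (2 * ‖x - u‖ + l * ‖φ‖) := by gcongr
    _ = _ := by field_simp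

/-- One step of the proximal algorithm, measured from a point `u` with `φ ∈ T u`. -/
theorem IsMaximalMonotoneOp.norm_sq_resolventMap_sub_le {T : H → Set H}
    (hT : IsMaximalMonotoneOp T) {l : ℝ} (hl : 0 < l) {u φ : H} (hφ : φ ∈ T u) (x : H) :
    ‖resolventMap T l x - u‖ ^ 2 + l ^ 2 * ‖yosida T l x‖ ^ 2 / 2 ≤
      ‖x - u‖ ^ 2 - 2 * (l * inner ℝ φ (x - u)) + 2 * (l ^ 2 * ‖φ‖ ^ 2) := by
  have h := hT.1 _ _ _ (hT.yosida_mem hl x) _ hφ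
  set g := yosida T l x with hg
  have e : resolventMap T l x - u = (x - u) - l • g := by rw [resolventMap_eq_sub hl]; abel
  rw [e] at h ⊢
  rw [norm_sub_sq_real, norm_smul, mul_pow, Real.norm_of_nonneg hl.le, real_inner_smul_right]
  rw [inner_sub_left, inner_sub_right g (x - u), inner_sub_right φ (x - u),
    real_inner_smul_right, real_inner_smul_right, real_inner_self_eq_norm_sq, real_inner_comm (x - u) g] at h
  have h2 := real_inner_le_norm φ g
  -- The cross term is absorbed by 2‖φ‖‖g‖ ≤ ‖g‖²/2 + 2‖φ‖², whence the factors 1/2 and 2 in the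
  -- statement.
  nlinarith [mul_nonneg hl.le h, mul_le_mul_of_nonneg_left h2 (sq_nonneg l),
    mul_nonneg (sq_nonneg l) (sq_nonneg (‖g‖ - 2 * ‖φ‖))]

/-- Lower bound for `⟪T_l x, x - u⟫` coming from monotonicity. -/
theorem IsMaximalMonotoneOp.inner_yosida_ge {T : H → Set H}
    (hT : IsMaximalMonotoneOp T) {l : ℝ} (hl : 0 < l) {u φ : H} (hφ : φ ∈ T u) (x : H) :
    inner ℝ φ (x - u) - l * (‖φ‖ * ‖yosida T l x‖) ≤ inner ℝ (yosida T l x) (x - u) := by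
  have h := hT.1 _ _ _ (hT.yosida_mem hl x) _ hφ
  set g := yosida T l x with hg
  have e : resolventMap T l x - u = (x - u) - l • g := by rw [resolventMap_eq_sub hl]; abel
  rw [e, inner_sub_left, inner_sub_right g (x - u), inner_sub_right φ (x - u),
    real_inner_smul_right, real_inner_smul_right, real_inner_self_eq_norm_sq] at h
  have h2 := real_inner_le_norm φ g
  nlinarith [mul_le_mul_of_nonneg_left h2 hl.le, mul_nonneg hl.le (sq_nonneg ‖g‖)]

theorem resolventMap_zero {l : ℝ} (hl : 0 < l) (x : H) :
    resolventMap (fun _ : H => ({0} : Set H)) l x = x := by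
  have h := isMaximalMonotoneOp_zero.yosida_mem (H := H) hl x
  rw [resolventMap_eq_sub hl, Set.mem_singleton_iff.1 h, smul_zero, sub_zero]

section Measurability

variable [SecondCountableTopology H] [MeasurableSpace H] [BorelSpace H]
  {E : Type*} [MeasurableSpace E] {A : E → H → Set H} {l : ℝ}

/-- A Carathéodory function, measurable in s and continuous in x, is jointly measurable. -/
theorem measurable_uncurry_resolventMap (hA : ∀ s, IsMaximalMonotoneOp (A s)) (hl : 0 < l)
    (hm : ∀ x, Measurable fun s => resolventMap (A s) l x) :
    Measurable fun p : E × H => resolventMap (A p.1) l p.2 := by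
  have := measurable_uncurry_of_continuous_of_measurable (u := fun (x : H) (s : E) =>
    resolventMap (A s) l x) (fun s => (hA s).continuous_resolventMap hl) hm
  exact this.comp measurable_swap

theorem measurable_uncurry_yosida (hA : ∀ s, IsMaximalMonotoneOp (A s)) (hl : 0 < l)
    (hm : ∀ x, Measurable fun s => resolventMap (A s) l x) :
    Measurable fun p : E × H => yosida (A p.1) l p.2 :=
  (measurable_snd.sub (measurable_uncurry_resolventMap hA hl hm)).const_smul _

end Measurability

end Resolvent

/-! ### Independent noise, conditional centring and L² martingale convergence. -/

section Noise

variable {E Ω β : Type*} [MeasurableSpace E] [mΩ : MeasurableSpace Ω] [MeasurableSpace β]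
  {μ : Measure E} {P : Measure Ω} {ζ : ℕ → Ω → E}

/-- The filtration whose `n`-th σ-algebra is generated by `ζ 0, …, ζ (n - 1)`. -/
def noiseFiltration (ζ : ℕ → Ω → E) (hζ : ∀ n, Measurable (ζ n)) : Filtration ℕ mΩ where
  seq n := ⨆ i ∈ Set.Iio n, MeasurableSpace.comap (ζ i) inferInstance
  mono' _ _ h := biSup_mono fun _ hi => lt_of_lt_of_le hi h
  le' _ := iSup₂_le fun i _ => (hζ i).comap_le

theorem measurable_noiseFiltration_succ (hζ : ∀ n, Measurable (ζ n)) (n : ℕ) :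
    Measurable[noiseFiltration ζ hζ (n + 1)] (ζ n) :=
  Measurable.of_comap_le (le_iSup₂_of_le (f := fun i (_ : i ∈ Set.Iio (n + 1)) =>
    MeasurableSpace.comap (ζ i) inferInstance) n (Nat.lt_succ_self n) le_rfl)

theorem indep_noiseFiltration (hζ : ∀ n, Measurable (ζ n)) (hind : iIndepFun ζ P) (n : ℕ) :
    Indep (noiseFiltration ζ hζ n) (MeasurableSpace.comap (ζ n) inferInstance) P := by
  have h := indep_iSup_of_disjoint (fun i => (hζ i).comap_le)
    ((iIndepFun_iff_iIndep _ _ _).1 hind) (S := Set.Iio n) (T := {n}) (by simp)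
  simp only [Set.mem_singleton_iff, iSup_iSup_eq_left] at h
  exact h

theorem indepFun_noise (hζ : ∀ n, Measurable (ζ n)) (hind : iIndepFun ζ P) {n : ℕ} {Z : Ω → β}
    (hZ : Measurable[noiseFiltration ζ hζ n] Z) : IndepFun (ζ n) Z P := by
  rw [IndepFun_iff_Indep]
  exact (indep_of_indep_of_le_left (indep_noiseFiltration hζ hind n) hZ.comap_le).symm

/-- The joint law of the fresh noise and of a variable depending on the past is a product. -/
theorem map_noise_prod [IsFiniteMeasure P] (hζ : ∀ n, Measurable (ζ n))
    (hlaw : ∀ n, P.map (ζ n) = μ) (hind : iIndepFun ζ P) {n : ℕ} {Z : Ω → β}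
    (hZ : Measurable[noiseFiltration ζ hζ n] Z) :
    P.map (fun ω => (ζ n ω, Z ω)) = μ.prod (P.map Z) := by
  have hZ' : Measurable Z := hZ.mono ((noiseFiltration ζ hζ).le n) le_rfl
  rw [(indepFun_noise hζ hind hZ).map_prod_eq_prod_map_map (hζ n).aemeasurable hZ'.aemeasurable,
    hlaw]

theorem lintegral_noise [IsFiniteMeasure P] [SFinite μ] (hζ : ∀ n, Measurable (ζ n))
    (hlaw : ∀ n, P.map (ζ n) = μ)
    (hind : iIndepFun ζ P) {n : ℕ} {Z : Ω → β} (hZ : Measurable[noiseFiltration ζ hζ n] Z)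
    {F : E × β → ℝ≥0∞} (hF : Measurable F) :
    ∫⁻ ω, F (ζ n ω, Z ω) ∂P = ∫⁻ ω, ∫⁻ s, F (s, Z ω) ∂μ ∂P := by
  have hZ' : Measurable Z := hZ.mono ((noiseFiltration ζ hζ).le n) le_rfl
  rw [← lintegral_map hF ((hζ n).prodMk hZ'), map_noise_prod hζ hlaw hind hZ,
    lintegral_prod_symm' _ hF, lintegral_map hF.lintegral_prod_left' hZ']

/-- The past is frozen while the fresh noise is integrated out: on a past event, Fubini for the
product law leaves the inner integral, which is zero. -/
theorem condExp_noise_eq_zero [IsProbabilityMeasure P] [SFinite μ] (hζ : ∀ n, Measurable (ζ n))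
    (hlaw : ∀ n, P.map (ζ n) = μ) (hind : iIndepFun ζ P) {n : ℕ} {X : Ω → β}
    (hX : Measurable[noiseFiltration ζ hζ n] X) {F : E × β → ℝ} (hF : Measurable F)
    (hint : Integrable (fun ω => F (ζ n ω, X ω)) P) (hmean : ∀ x, ∫ s, F (s, x) ∂μ = 0) :
    P[fun ω => F (ζ n ω, X ω) | noiseFiltration ζ hζ n] =ᵐ[P] 0 := by
  have hle := (noiseFiltration ζ hζ).le n
  refine (ae_eq_condExp_of_forall_setIntegral_eq hle hint (fun s _ _ => integrableOn_zero) ?_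
    aestronglyMeasurable_zero).symm
  intro B hB _
  have hB' := hle _ hB
  have hX' : Measurable X := hX.mono hle le_rfl
  -- Bundling the indicator of the test event with X gives a single past variable, so
  -- `map_noise_prod` applies.
  let Z : Ω → ℝ × β := fun ω => (B.indicator (fun _ => 1) ω, X ω)
  have hZ : Measurable[noiseFiltration ζ hζ n] Z :=
    ((@measurable_const ℝ Ω _ (noiseFiltration ζ hζ n) 1).indicator hB).prodMk hX
  have hZ' : Measurable Z := hZ.mono hle le_rfl
  let K : E × (ℝ × β) → ℝ := fun p => p.2.1 * F (p.1, p.2.2)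
  have hK : Measurable K := by fun_prop
  have e : ∀ ω, B.indicator (fun ω => F (ζ n ω, X ω)) ω = K (ζ n ω, Z ω) := by
    intro ω
    by_cases hω : ω ∈ B <;> simp [K, Z, hω]
  have hKint : Integrable K (μ.prod (P.map Z)) := by
    rw [← map_noise_prod hζ hlaw hind hZ,
      integrable_map_measure hK.aestronglyMeasurable ((hζ n).prodMk hZ').aemeasurable]
    exact (hint.indicator hB').congr (Eventually.of_forall e)
  simp only [integral_zero]
  rw [← integral_indicator hB', integral_congr_ae (Eventually.of_forall e),
    ← integral_map (f := K) (φ := fun ω => (ζ n ω, Z ω)) ((hζ n).prodMk hZ').aemeasurable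
      hK.aestronglyMeasurable,
    map_noise_prod hζ hlaw hind hZ, integral_prod_symm _ hKint]
  simp [K, integral_const_mul, hmean]

/-- Square-summable martingale noise is almost surely summable. -/
theorem ae_tendsto_sum_noise [IsProbabilityMeasure P] [SFinite μ] (hζ : ∀ n, Measurable (ζ n))
    (hlaw : ∀ n, P.map (ζ n) = μ) (hind : iIndepFun ζ P) {X : ℕ → Ω → β}
    (hX : ∀ n, Measurable[noiseFiltration ζ hζ n] (X n)) {F : ℕ → E × β → ℝ}
    (hF : ∀ n, Measurable (F n)) (hmean : ∀ n x, ∫ s, F n (s, x) ∂μ = 0)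
    (hL2 : ∀ n, MemLp (fun ω => F n (ζ n ω, X n ω)) 2 P) {C : ℝ}
    (hC : ∀ n, ∑ k ∈ Finset.range n, ∫ ω, F k (ζ k ω, X k ω) ^ 2 ∂P ≤ C) :
    ∀ᵐ ω ∂P, ∃ c, Tendsto (fun n => ∑ k ∈ Finset.range n, F k (ζ k ω, X k ω)) atTop (𝓝 c) := by
  set ℱ := noiseFiltration ζ hζ with hℱ
  set D : ℕ → Ω → ℝ := fun n ω => F n (ζ n ω, X n ω) with hD
  set M : ℕ → Ω → ℝ := fun n ω => ∑ k ∈ Finset.range n, D k ω with hM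
  have hDm : ∀ n, Measurable[ℱ (n + 1)] (D n) := fun n =>
    (hF n).comp ((measurable_noiseFiltration_succ hζ n).prodMk
      ((hX n).mono (ℱ.mono n.le_succ) le_rfl))
  have hMm : ∀ n, Measurable[ℱ n] (M n) := fun n =>
    Finset.measurable_fun_sum _ fun k hk =>
      (hDm k).mono (ℱ.mono (Nat.succ_le_of_lt (Finset.mem_range.1 hk))) le_rfl
  have hML2 : ∀ n, MemLp (M n) 2 P := fun n => memLp_finsetSum _ fun k _ => hL2 k
  have hcond : ∀ n, P[D n | ℱ n] =ᵐ[P] 0 := fun n =>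
    condExp_noise_eq_zero hζ hlaw hind (hX n) (hF n) ((hL2 n).integrable one_le_two) (hmean n)
  have hmart : Martingale M ℱ P := by
    refine martingale_of_condExp_sub_eq_zero_nat (fun n => (hMm n).stronglyMeasurable)
      (fun n => (hML2 n).integrable one_le_two) fun n => ?_
    have : M (n + 1) - M n = D n := by
      funext ω; simp [hM, Finset.sum_range_succ]
    rw [this]
    exact hcond n
  -- Orthogonality of increments: the second moment of M is then the sum of those of the increments,
  -- bounded by C.
  have horth : ∀ n, ∫ ω, M n ω * D n ω ∂P = 0 := by
    intro n
    have h1 : Integrable (M n * D n) P := (hML2 n).integrable_mul (hL2 n)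
    have h2 := condExp_mul_of_stronglyMeasurable_left (hMm n).stronglyMeasurable h1
      ((hL2 n).integrable one_le_two)
    have h3 : P[M n * D n | ℱ n] =ᵐ[P] 0 := by
      filter_upwards [h2, hcond n] with ω h2 h3
      rw [h2, Pi.mul_apply, h3]; simp
    have h4 := integral_condExp (μ := P) (ℱ.le n) (f := M n * D n)
    rw [integral_congr_ae h3] at h4
    simpa using h4.symm
  have hsq : ∀ n, ∫ ω, M n ω ^ 2 ∂P = ∑ k ∈ Finset.range n, ∫ ω, D k ω ^ 2 ∂P := by
    intro n
    induction n with
    | zero => simp [hM]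
    | succ n ih =>
      rw [Finset.sum_range_succ, ← ih]
      have e : ∀ ω, M (n + 1) ω ^ 2 = M n ω ^ 2 + 2 * (M n ω * D n ω) + D n ω ^ 2 := by
        intro ω
        simp only [hM, Finset.sum_range_succ]; ring
      simp only [e]
      have i1 := (hML2 n).integrable_sq
      have i2 : Integrable (fun ω => 2 * (M n ω * D n ω)) P :=
        ((hML2 n).integrable_mul (hL2 n)).const_mul 2
      have i3 : Integrable (fun ω => M n ω ^ 2 + 2 * (M n ω * D n ω)) P := i1.add i2
      rw [integral_add i3 (hL2 n).integrable_sq, integral_add i1 i2,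
        integral_const_mul, horth]
      ring
  have hbdd : ∀ n, eLpNorm (M n) 1 P ≤ ((1 + C).toNNReal : ℝ≥0∞) := by
    intro n
    have i1 := (hML2 n).integrable one_le_two
    rw [eLpNorm_one_eq_lintegral_enorm, ← ofReal_integral_norm_eq_lintegral_enorm i1]
    refine ENNReal.ofReal_le_ofReal ?_
    calc ∫ ω, ‖M n ω‖ ∂P ≤ ∫ ω, (1 + M n ω ^ 2) ∂P := by
          refine integral_mono i1.norm ((integrable_const 1).add (hML2 n).integrable_sq) fun ω => ?_
          simp only [Real.norm_eq_abs]
          rw [← sq_abs]; nlinarith [sq_nonneg (|M n ω| - 1), abs_nonneg (M n ω)]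
      _ = 1 + ∫ ω, M n ω ^ 2 ∂P := by
          rw [integral_add (integrable_const 1) (hML2 n).integrable_sq]; simp
      _ ≤ 1 + C := by
          rw [hsq]; gcongr; exact hC n
  exact hmart.submartingale.exists_ae_tendsto_of_bdd hbdd

/-- Square-summable noise is almost surely summable after centering. -/
theorem ae_tendsto_sum_centered_noise [IsProbabilityMeasure P] [IsProbabilityMeasure μ]
    (hζ : ∀ n, Measurable (ζ n))
    (hlaw : ∀ n, P.map (ζ n) = μ) (hind : iIndepFun ζ P) {X : ℕ → Ω → β}
    (hX : ∀ n, Measurable[noiseFiltration ζ hζ n] (X n)) {f : ℕ → E × β → ℝ}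
    (hf : ∀ n, Measurable (f n)) (hfμ : ∀ n x, MemLp (fun s => f n (s, x)) 2 μ)
    (hL2 : ∀ n, MemLp (fun ω => f n (ζ n ω, X n ω)) 2 P) {C : ℝ}
    (hC : ∀ n, ∑ k ∈ Finset.range n, ∫ ω, f k (ζ k ω, X k ω) ^ 2 ∂P ≤ C) :
    ∀ᵐ ω ∂P, ∃ c, Tendsto (fun n => ∑ k ∈ Finset.range n,
      (f k (ζ k ω, X k ω) - ∫ s, f k (s, X k ω) ∂μ)) atTop (𝓝 c) := by
  have hX' : ∀ n, Measurable (X n) := fun n => (hX n).mono ((noiseFiltration ζ hζ).le n) le_rfl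
  have hm : ∀ n, Measurable fun x => ∫ s, f n (s, x) ∂μ := fun n =>
    (hf n).stronglyMeasurable.integral_prod_left'.measurable
  -- Jensen's inequality in the form of a nonnegative variance.
  have hle : ∀ n x, ENNReal.ofReal ((∫ s, f n (s, x) ∂μ) ^ 2) ≤
      ∫⁻ s, ENNReal.ofReal (f n (s, x) ^ 2) ∂μ := by
    intro n x
    rw [← ofReal_integral_eq_lintegral_ofReal (hfμ n x).integrable_sq
      (Eventually.of_forall fun s => sq_nonneg _)]
    refine ENNReal.ofReal_le_ofReal ?_
    have h := variance_nonneg (fun s => f n (s, x)) μ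
    rw [variance_eq_sub (hfμ n x)] at h
    simpa using h
  have hle' : ∀ n, ∫⁻ ω, ENNReal.ofReal ((∫ s, f n (s, X n ω) ∂μ) ^ 2) ∂P ≤
      ENNReal.ofReal (∫ ω, f n (ζ n ω, X n ω) ^ 2 ∂P) := by
    intro n
    rw [ofReal_integral_eq_lintegral_ofReal (hL2 n).integrable_sq
      (Eventually.of_forall fun s => sq_nonneg _),
      lintegral_noise hζ hlaw hind (hX n) (F := fun p => ENNReal.ofReal (f n p ^ 2))
        ((hf n).pow_const 2).ennreal_ofReal]
    exact lintegral_mono fun ω => hle n (X n ω)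
  have hmL2 : ∀ n, MemLp (fun ω => ∫ s, f n (s, X n ω) ∂μ) 2 P := by
    intro n
    have hmeas : Measurable fun ω => ∫ s, f n (s, X n ω) ∂μ := (hm n).comp (hX' n)
    rw [memLp_two_iff_integrable_sq hmeas.aestronglyMeasurable]
    refine ⟨(hmeas.pow_const 2).aestronglyMeasurable, ?_⟩
    rw [hasFiniteIntegral_iff_ofReal (Eventually.of_forall fun s => sq_nonneg _)]
    exact (hle' n).trans_lt ENNReal.ofReal_lt_top
  have hmC : ∀ n, ∫ ω, (∫ s, f n (s, X n ω) ∂μ) ^ 2 ∂P ≤ ∫ ω, f n (ζ n ω, X n ω) ^ 2 ∂P := by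
    intro n
    rw [← ENNReal.ofReal_le_ofReal_iff (integral_nonneg fun _ => sq_nonneg _),
      ofReal_integral_eq_lintegral_ofReal (hmL2 n).integrable_sq
      (Eventually.of_forall fun s => sq_nonneg _)]
    exact hle' n
  -- The factor 4 comes from (a - b)² ≤ 2a² + 2b², both second moments being at most that of f.
  refine ae_tendsto_sum_noise hζ hlaw hind hX
    (F := fun n p => f n p - ∫ s, f n (s, p.2) ∂μ) (C := 4 * C)
    (fun n => (hf n).sub ((hm n).comp measurable_snd)) ?_ (fun n => (hL2 n).sub (hmL2 n)) ?_
  · intro n x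
    dsimp only
    rw [integral_sub ((hfμ n x).integrable one_le_two) (integrable_const _)]
    simp
  · intro n
    refine le_trans ?_ (mul_le_mul_of_nonneg_left (hC n) (by norm_num : (0 : ℝ) ≤ 4))
    rw [Finset.mul_sum]
    refine Finset.sum_le_sum fun k _ => ?_
    have i1 : Integrable (fun ω => 2 * f k (ζ k ω, X k ω) ^ 2) P :=
      (hL2 k).integrable_sq.const_mul 2
    have i2 : Integrable (fun ω => 2 * (∫ s, f k (s, X k ω) ∂μ) ^ 2) P :=
      (hmL2 k).integrable_sq.const_mul 2
    calc _ ≤ ∫ ω, (2 * f k (ζ k ω, X k ω) ^ 2 + 2 * (∫ s, f k (s, X k ω) ∂μ) ^ 2) ∂P := by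
          refine integral_mono ((hL2 k).sub (hmL2 k)).integrable_sq (i1.add i2) fun ω => ?_
          dsimp only
          nlinarith [sq_nonneg (f k (ζ k ω, X k ω) + ∫ s, f k (s, X k ω) ∂μ)]
      _ ≤ _ := by
          rw [integral_add i1 i2, integral_const_mul, integral_const_mul]
          linarith [hmC k]

end Noise

/-! ### Almost sure summability from summable expectations. -/

section Summability

variable {α : Type*} [MeasurableSpace α] {ν : Measure α}

theorem ae_tsum_ne_top {f : ℕ → α → ℝ≥0∞} (hf : ∀ n, Measurable (f n))
    (h : ∑' n, ∫⁻ a, f n a ∂ν ≠ ∞) : ∀ᵐ a ∂ν, ∑' n, f n a ≠ ∞ := by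
  rw [← lintegral_tsum fun n => (hf n).aemeasurable] at h
  filter_upwards [ae_lt_top (Measurable.tsum hf) h] with a ha using ha.ne

theorem summable_of_tsum_ofReal_ne_top {f : ℕ → ℝ} (hf : ∀ n, 0 ≤ f n)
    (h : ∑' n, ENNReal.ofReal (f n) ≠ ∞) : Summable f := by
  simpa [ENNReal.toReal_ofReal, hf] using ENNReal.summable_toReal h

theorem tsum_lintegral_ofReal_ne_top {f : ℕ → α → ℝ} (hf : ∀ n a, 0 ≤ f n a)
    (hi : ∀ n, Integrable (f n) ν) {C : ℝ}
    (hC : ∀ n, ∑ k ∈ Finset.range n, ∫ a, f k a ∂ν ≤ C) :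
    ∑' n, ∫⁻ a, ENNReal.ofReal (f n a) ∂ν ≠ ∞ := by
  have h := (summable_of_sum_range_le
    (fun n => integral_nonneg (μ := ν) (hf n)) hC).tsum_ofReal_ne_top
  simpa only [ofReal_integral_eq_lintegral_ofReal (hi _) (Eventually.of_forall (hf _))] using h

theorem ae_summable_of_sum_integral_le {f : ℕ → α → ℝ} (hf : ∀ n a, 0 ≤ f n a)
    (hm : ∀ n, Measurable (f n)) (hi : ∀ n, Integrable (f n) ν) {C : ℝ}
    (hC : ∀ n, ∑ k ∈ Finset.range n, ∫ a, f k a ∂ν ≤ C) :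
    ∀ᵐ a ∂ν, Summable fun n => f n a := by
  filter_upwards [ae_tsum_ne_top (fun n => (hm n).ennreal_ofReal)
    (tsum_lintegral_ofReal_ne_top hf hi hC)] with a ha
  exact summable_of_tsum_ofReal_ne_top (fun n => hf n a) ha

end Summability

theorem integral_inner_eq_zero {H E : Type*} [NormedAddCommGroup H] [InnerProductSpace ℝ H]
    [CompleteSpace H] [MeasurableSpace E] {μ : Measure E} {φ : E → H} (hφ : Integrable φ μ)
    (h0 : ∫ s, φ s ∂μ = 0) (c : ℝ) (x : H) : ∫ s, c * inner ℝ (φ s) x ∂μ = 0 := by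
  simp_rw [integral_const_mul, fun s => real_inner_comm x (φ s), integral_inner hφ, h0]
  simp

/-! ### The algorithm: energy estimates and behaviour of almost every path. -/

section Scheme

variable {H : Type*} [NormedAddCommGroup H] [InnerProductSpace ℝ H] [MeasurableSpace H]
  {E Ω : Type*} [MeasurableSpace E] [MeasurableSpace Ω]

/-- The stochastic proximal point algorithm driven by the i.i.d. noise `ζ`, for operators that
are all maximal monotone. -/
structure IsProximalScheme (μ : Measure E) (P : Measure Ω) (A : E → H → Set H) (lam : ℕ → ℝ)
    (ζ : ℕ → Ω → E) (X : ℕ → Ω → H) : Prop where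
  isMax : ∀ s, IsMaximalMonotoneOp (A s)
  meas : ∀ l : ℝ, 0 < l → ∀ x : H, Measurable fun s => resolventMap (A s) l x
  lam_pos : ∀ n, 0 < lam n
  lam_sq : Summable fun n => lam n ^ 2
  noise_meas : ∀ n, Measurable (ζ n)
  noise_law : ∀ n, P.map (ζ n) = μ
  noise_indep : iIndepFun ζ P
  init : ∃ x₀, ∀ ω, X 0 ω = x₀
  step : ∀ n ω, X (n + 1) ω = resolventMap (A (ζ n ω)) (lam n) (X n ω)

namespace IsProximalScheme

variable {μ : Measure E} {P : Measure Ω}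
  {A : E → H → Set H} {lam : ℕ → ℝ} {ζ : ℕ → Ω → E} {X : ℕ → Ω → H}

theorem measurePreserving (h : IsProximalScheme μ P A lam ζ X) (n : ℕ) :
    MeasurePreserving (ζ n) P μ := ⟨h.noise_meas n, h.noise_law n⟩

theorem ae_noise_mem (h : IsProximalScheme μ P A lam ζ X) {u : H} {φ : E → H}
    (hφ : ∀ᵐ s ∂μ, φ s ∈ A s u) : ∀ᵐ ω ∂P, ∀ n, φ (ζ n ω) ∈ A (ζ n ω) u :=
  ae_all_iff.2 fun n => (h.measurePreserving n).quasiMeasurePreserving.ae hφ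

theorem smul_yosida_eq (h : IsProximalScheme μ P A lam ζ X) (n : ℕ) (ω : Ω) :
    lam n • yosida (A (ζ n ω)) (lam n) (X n ω) = (X n ω) - X (n + 1) ω := by
  rw [h.step, resolventMap_eq_sub (h.lam_pos n), sub_sub_cancel]

theorem integrable_sq_selection (h : IsProximalScheme μ P A lam ζ X) {φ : E → H}
    (hφ : MemLp φ 2 μ) (n : ℕ) : Integrable (fun ω => ‖φ (ζ n ω)‖ ^ 2) P :=
  (hφ.comp_measurePreserving (h.measurePreserving n)).integrable_norm_pow two_ne_zero

theorem integral_sq_selection [OpensMeasurableSpace H] (h : IsProximalScheme μ P A lam ζ X)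
    {φ : E → H} (hφ : Measurable φ) (n : ℕ) : ∫ ω, ‖φ (ζ n ω)‖ ^ 2 ∂P = ∫ s, ‖φ s‖ ^ 2 ∂μ := by
  rw [← h.noise_law n, integral_map (h.noise_meas n).aemeasurable
    (hφ.norm.pow_const 2).aestronglyMeasurable]

variable [CompleteSpace H]

theorem ae_step_le (h : IsProximalScheme μ P A lam ζ X) {u : H} {φ : E → H}
    (hφ : φ ∈ selections μ 2 fun s => A s u) : ∀ᵐ ω ∂P, ∀ n,
    ‖X (n + 1) ω - u‖ ^ 2 + lam n ^ 2 * ‖yosida (A (ζ n ω)) (lam n) (X n ω)‖ ^ 2 / 2 ≤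
      ‖X n ω - u‖ ^ 2 - 2 * (lam n * inner ℝ (φ (ζ n ω)) (X n ω - u))
        + 2 * (lam n ^ 2 * ‖φ (ζ n ω)‖ ^ 2) := by
  filter_upwards [h.ae_noise_mem hφ.2.1] with ω hω n
  rw [h.step]
  exact (h.isMax _).norm_sq_resolventMap_sub_le (h.lam_pos n) (hω n) _

variable [SecondCountableTopology H] [BorelSpace H]

theorem measurable_iterate (h : IsProximalScheme μ P A lam ζ X) (n : ℕ) :
    Measurable[noiseFiltration ζ h.noise_meas n] (X n) := by
  induction n with
  | zero =>
    obtain ⟨x₀, hx₀⟩ := h.init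
    rw [funext hx₀]
    exact measurable_const
  | succ n ih =>
    rw [funext (h.step n)]
    exact (measurable_uncurry_resolventMap h.isMax (h.lam_pos n) (h.meas _ (h.lam_pos n))).comp
      ((measurable_noiseFiltration_succ h.noise_meas n).prodMk
        (ih.mono ((noiseFiltration ζ h.noise_meas).mono n.le_succ) le_rfl))

theorem measurable_iterate' (h : IsProximalScheme μ P A lam ζ X) (n : ℕ) : Measurable (X n) :=
  (h.measurable_iterate n).mono ((noiseFiltration ζ h.noise_meas).le n) le_rfl

theorem measurable_yosida (h : IsProximalScheme μ P A lam ζ X) (n : ℕ) :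
    Measurable fun p : E × H => yosida (A p.1) (lam n) p.2 :=
  measurable_uncurry_yosida h.isMax (h.lam_pos n) (h.meas _ (h.lam_pos n))

theorem measurable_sq_yosida (h : IsProximalScheme μ P A lam ζ X) (n : ℕ) :
    Measurable fun p : E × H => lam n ^ 2 * ‖yosida (A p.1) (lam n) p.2‖ ^ 2 :=
  ((h.measurable_yosida n).norm.pow_const 2).const_mul _

/-- One square-integrable selection at a single point u suffices for every x, because the Yosida
approximation is Lipschitz in x for a fixed parameter. -/
theorem memLp_yosida [IsProbabilityMeasure μ] (h : IsProximalScheme μ P A lam ζ X) {u : H}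
    {φ : E → H} (hφ : φ ∈ selections μ 2 fun s => A s u) (n : ℕ) (x : H) :
    MemLp (fun s => yosida (A s) (lam n) x) 2 μ := by
  have hc : MemLp (fun _ : E => (lam n)⁻¹ * (2 * ‖x - u‖)) 2 μ := memLp_const _
  have hb : MemLp (fun s => (lam n)⁻¹ * (2 * ‖x - u‖) + ‖φ s‖) 2 μ := hc.add hφ.2.2.norm
  refine hb.of_le ((h.measurable_yosida n).comp measurable_prodMk_right).aestronglyMeasurable ?_
  filter_upwards [hφ.2.1] with s hs
  exact ((h.isMax s).norm_yosida_le_add (h.lam_pos n) hs x).trans (le_abs_self _)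

variable [IsProbabilityMeasure P]

theorem memLp_iterate (h : IsProximalScheme μ P A lam ζ X) {u : H} {φ : E → H}
    (hφ : φ ∈ selections μ 2 fun s => A s u) (n : ℕ) : MemLp (fun ω => X n ω - u) 2 P := by
  induction n with
  | zero =>
    obtain ⟨x₀, hx₀⟩ := h.init
    simp only [hx₀]
    exact memLp_const _
  | succ n ih =>
    have hb : MemLp (fun ω => ‖X n ω - u‖ + lam n * ‖φ (ζ n ω)‖) 2 P :=
      ih.norm.add ((hφ.2.2.comp_measurePreserving (h.measurePreserving n)).norm.const_mul _)
    refine hb.of_le ((h.measurable_iterate' _).sub_const u).aestronglyMeasurable ?_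
    filter_upwards [h.ae_noise_mem hφ.2.1] with ω hω
    rw [h.step]
    exact ((h.isMax _).norm_resolventMap_sub_le_add (h.lam_pos n) (hω n) _).trans (le_abs_self _)

theorem memLp_smul_yosida (h : IsProximalScheme μ P A lam ζ X) {u : H} {φ : E → H}
    (hφ : φ ∈ selections μ 2 fun s => A s u) (n : ℕ) :
    MemLp (fun ω => lam n • yosida (A (ζ n ω)) (lam n) (X n ω)) 2 P := by
  simp only [h.smul_yosida_eq]
  convert (h.memLp_iterate hφ n).sub (h.memLp_iterate hφ (n + 1)) using 1
  funext ω
  simp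

theorem integrable_sq_yosida (h : IsProximalScheme μ P A lam ζ X) {u : H} {φ : E → H}
    (hφ : φ ∈ selections μ 2 fun s => A s u) (n : ℕ) :
    Integrable (fun ω => lam n ^ 2 * ‖yosida (A (ζ n ω)) (lam n) (X n ω)‖ ^ 2) P := by
  refine (h.memLp_smul_yosida hφ n).integrable_norm_pow two_ne_zero |>.congr
    (Eventually.of_forall fun ω => ?_)
  simp only [norm_smul, mul_pow, Real.norm_eq_abs, sq_abs]

theorem integrable_sq_iterate (h : IsProximalScheme μ P A lam ζ X) {u : H} {φ : E → H}
    (hφ : φ ∈ selections μ 2 fun s => A s u) (n : ℕ) :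
    Integrable (fun ω => ‖X n ω - u‖ ^ 2) P :=
  (h.memLp_iterate hφ n).integrable_norm_pow two_ne_zero

/-- The noise `lam n * ⟪φ (ζ n), X n - u⟫` is square integrable, with an explicit bound. -/
theorem memLp_noise (h : IsProximalScheme μ P A lam ζ X) {u : H} {φ : E → H}
    (hφ : φ ∈ selections μ 2 fun s => A s u) (n : ℕ) :
    MemLp (fun ω => lam n * inner ℝ (φ (ζ n ω)) (X n ω - u)) 2 P ∧
    ∫ ω, (lam n * inner ℝ (φ (ζ n ω)) (X n ω - u)) ^ 2 ∂P ≤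
      lam n ^ 2 * ((∫ s, ‖φ s‖ ^ 2 ∂μ) * ∫ ω, ‖X n ω - u‖ ^ 2 ∂P) := by
  have hφm := hφ.1
  have hXm := h.measurable_iterate' n
  have hζm := h.noise_meas n
  -- X n only uses the noise before time n. Independence is what makes the product of these two
  -- integrable variables integrable.
  have hind : IndepFun (fun ω => ‖φ (ζ n ω)‖ ^ 2) (fun ω => ‖X n ω - u‖ ^ 2) P :=
    (indepFun_noise h.noise_meas h.noise_indep (h.measurable_iterate n)).comp
      (φ := fun s => ‖φ s‖ ^ 2) (ψ := fun x => ‖x - u‖ ^ 2) (by fun_prop) (by fun_prop)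
  have i1 := h.integrable_sq_selection hφ.2.2 n
  have i2 := h.integrable_sq_iterate hφ n
  have i3 : Integrable (fun ω => lam n ^ 2 * (‖φ (ζ n ω)‖ ^ 2 * ‖X n ω - u‖ ^ 2)) P :=
    (hind.integrable_mul i1 i2).const_mul _
  have hle : ∀ ω, (lam n * inner ℝ (φ (ζ n ω)) (X n ω - u)) ^ 2 ≤
      lam n ^ 2 * (‖φ (ζ n ω)‖ ^ 2 * ‖X n ω - u‖ ^ 2) := by
    intro ω
    rw [mul_pow, ← mul_pow ‖_‖, ← sq_abs (inner ℝ (φ (ζ n ω)) (X n ω - u))]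
    gcongr
    exact abs_real_inner_le_norm _ _
  have hm : Measurable fun ω => lam n * inner ℝ (φ (ζ n ω)) (X n ω - u) := by fun_prop
  have i4 : Integrable (fun ω => (lam n * inner ℝ (φ (ζ n ω)) (X n ω - u)) ^ 2) P :=
    i3.mono' (hm.pow_const 2).aestronglyMeasurable (Eventually.of_forall fun ω => by
      rw [Real.norm_of_nonneg (sq_nonneg _)]; exact hle ω)
  refine ⟨(memLp_two_iff_integrable_sq hm.aestronglyMeasurable).2 i4, ?_⟩
  refine (integral_mono i4 i3 hle).trans_eq ?_
  rw [integral_const_mul, ← h.integral_sq_selection hφ.1 n]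
  congr 1
  exact hind.integral_mul_eq_mul_integral i1.aestronglyMeasurable i2.aestronglyMeasurable

variable [IsProbabilityMeasure μ]

theorem integral_noise_eq_zero (h : IsProximalScheme μ P A lam ζ X) {u : H} {φ : E → H}
    (hφ : φ ∈ selections μ 2 fun s => A s u) (h0 : ∫ s, φ s ∂μ = 0) (n : ℕ) :
    ∫ ω, lam n * inner ℝ (φ (ζ n ω)) (X n ω - u) ∂P = 0 := by
  have hφm := hφ.1
  have hc := condExp_noise_eq_zero h.noise_meas h.noise_law h.noise_indep
    (h.measurable_iterate n) (F := fun p => lam n * inner ℝ (φ p.1) (p.2 - u)) (by fun_prop)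
    ((h.memLp_noise hφ n).1.integrable one_le_two)
    (fun x => integral_inner_eq_zero (hφ.2.2.integrable one_le_two) h0 (lam n) (x - u))
  rw [← integral_condExp ((noiseFiltration ζ h.noise_meas).le n), integral_congr_ae hc]
  simp

/-- Mean-square estimate at a zero of the mean operator. -/
theorem exists_energy_bound (h : IsProximalScheme μ P A lam ζ X) {u : H} {φ : E → H}
    (hφ : φ ∈ selections μ 2 fun s => A s u) (h0 : ∫ s, φ s ∂μ = 0) :
    ∃ C : ℝ, (∀ n, ∫ ω, ‖X n ω - u‖ ^ 2 ∂P ≤ C) ∧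
      ∀ n, ∑ k ∈ Finset.range n,
        ∫ ω, lam k ^ 2 * ‖yosida (A (ζ k ω)) (lam k) (X k ω)‖ ^ 2 ∂P ≤ C := by
  set K := ∫ s, ‖φ s‖ ^ 2 ∂μ with hK
  have hK0 : 0 ≤ K := integral_nonneg fun _ => sq_nonneg _
  set G : ℕ → ℝ := fun k => ∫ ω, lam k ^ 2 * ‖yosida (A (ζ k ω)) (lam k) (X k ω)‖ ^ 2 ∂P with hG
  have hG0 : ∀ k, 0 ≤ G k := fun k => integral_nonneg fun _ => by positivity
  -- Expectation of the one-step inequality; the term linear in φ has mean zero.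
  have hstep : ∀ n, ∫ ω, ‖X (n + 1) ω - u‖ ^ 2 ∂P + G n / 2 ≤
      ∫ ω, ‖X n ω - u‖ ^ 2 ∂P + 2 * (lam n ^ 2 * K) := by
    intro n
    have i1 := h.integrable_sq_iterate hφ (n + 1)
    have i2 := (h.integrable_sq_yosida hφ n).div_const 2
    have i3 := h.integrable_sq_iterate hφ n
    have i4 := ((h.memLp_noise hφ n).1.integrable one_le_two).const_mul 2
    have i5 := ((h.integrable_sq_selection hφ.2.2 n).const_mul (lam n ^ 2)).const_mul 2
    have hm := integral_mono_ae (i1.add i2) ((i3.sub i4).add i5) (by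
      filter_upwards [h.ae_step_le hφ] with ω hω using hω n)
    rw [integral_add' i1 i2, integral_add' (i3.sub i4) i5, integral_sub' i3 i4,
      integral_const_mul 2, integral_const_mul 2, integral_const_mul (lam n ^ 2),
      h.integral_noise_eq_zero hφ h0, h.integral_sq_selection hφ.1, integral_div] at hm
    simpa using hm
  have hsum : ∀ n, ∫ ω, ‖X n ω - u‖ ^ 2 ∂P + (∑ k ∈ Finset.range n, G k) / 2 ≤
      ∫ ω, ‖X 0 ω - u‖ ^ 2 ∂P + 2 * ((∑ k ∈ Finset.range n, lam k ^ 2) * K) := by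
    intro n
    induction n with
    | zero => simp
    | succ n ih =>
      rw [Finset.sum_range_succ, Finset.sum_range_succ]
      linarith [hstep n]
  have hV0 : ∀ n, 0 ≤ ∫ ω, ‖X n ω - u‖ ^ 2 ∂P := fun n => integral_nonneg fun _ => sq_nonneg _
  set B := ∫ ω, ‖X 0 ω - u‖ ^ 2 ∂P + 2 * ((∑' k, lam k ^ 2) * K) with hB
  have hle : ∀ n, ∫ ω, ‖X n ω - u‖ ^ 2 ∂P + (∑ k ∈ Finset.range n, G k) / 2 ≤ B := by
    intro n
    refine (hsum n).trans ?_
    rw [hB]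
    gcongr
    exact h.lam_sq.sum_le_tsum _ fun _ _ => sq_nonneg _
  refine ⟨2 * B, fun n => ?_, fun n => ?_⟩ <;>
  · have h1 := hle n
    have h2 := hV0 n
    have h3 : 0 ≤ ∑ k ∈ Finset.range n, G k := Finset.sum_nonneg fun k _ => hG0 k
    linarith

theorem ae_summable_sq_yosida (h : IsProximalScheme μ P A lam ζ X) {u : H} {φ : E → H}
    (hφ : φ ∈ selections μ 2 fun s => A s u) (h0 : ∫ s, φ s ∂μ = 0) :
    ∀ᵐ ω ∂P, Summable fun n => lam n ^ 2 * ‖yosida (A (ζ n ω)) (lam n) (X n ω)‖ ^ 2 := by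
  obtain ⟨C, -, hC⟩ := h.exists_energy_bound hφ h0
  exact ae_summable_of_sum_integral_le (fun n ω => by positivity)
    (fun n => (h.measurable_sq_yosida n).comp
      ((h.noise_meas n).prodMk (h.measurable_iterate' n)))
    (h.integrable_sq_yosida hφ) hC

/-- As ζ n is independent of X n, the sampled energy and its μ-average at X n have equal
expectation, so the energy bound also controls the latter. -/
theorem ae_summable_integral_sq_yosida (h : IsProximalScheme μ P A lam ζ X) {u : H} {φ : E → H}
    (hφ : φ ∈ selections μ 2 fun s => A s u) (h0 : ∫ s, φ s ∂μ = 0) :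
    ∀ᵐ ω ∂P, Summable fun n => lam n ^ 2 * ∫ s, ‖yosida (A s) (lam n) (X n ω)‖ ^ 2 ∂μ := by
  obtain ⟨C, -, hC⟩ := h.exists_energy_bound hφ h0
  have hne := tsum_lintegral_ofReal_ne_top (fun n ω => by positivity)
    (h.integrable_sq_yosida hφ) hC
  have hF : ∀ n, Measurable fun p : E × H =>
      ENNReal.ofReal (lam n ^ 2 * ‖yosida (A p.1) (lam n) p.2‖ ^ 2) :=
    fun n => (h.measurable_sq_yosida n).ennreal_ofReal
  have e := fun n => lintegral_noise h.noise_meas h.noise_law h.noise_indep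
    (h.measurable_iterate n) (hF n)
  simp only [e] at hne
  filter_upwards [ae_tsum_ne_top
    (fun n => (hF n).lintegral_prod_left'.comp (h.measurable_iterate' n)) hne] with ω hω
  refine summable_of_tsum_ofReal_ne_top
    (fun n => mul_nonneg (sq_nonneg _) (integral_nonneg fun _ => sq_nonneg _)) ?_
  convert hω using 4 with n
  rw [Function.comp_apply, ← integral_const_mul, ofReal_integral_eq_lintegral_ofReal
    (((h.memLp_yosida hφ n _).integrable_norm_pow two_ne_zero).const_mul _)
    (Eventually.of_forall fun _ => by positivity)]

/-- The distance of the iterates to a zero of the mean operator converges almost surely. -/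
theorem ae_tendsto_norm_sq (h : IsProximalScheme μ P A lam ζ X) {u : H} {φ : E → H}
    (hφ : φ ∈ selections μ 2 fun s => A s u) (h0 : ∫ s, φ s ∂μ = 0) :
    ∀ᵐ ω ∂P, ∃ c, Tendsto (fun n => ‖X n ω - u‖ ^ 2) atTop (𝓝 c) := by
  have hφm := hφ.1
  obtain ⟨C, hC, -⟩ := h.exists_energy_bound hφ h0
  set K := ∫ s, ‖φ s‖ ^ 2 ∂μ with hK
  have hK0 : 0 ≤ K := integral_nonneg fun _ => sq_nonneg _
  have hC0 : 0 ≤ C := (integral_nonneg fun _ => sq_nonneg _).trans (hC 0)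
  have hnoise := ae_tendsto_sum_noise h.noise_meas h.noise_law h.noise_indep
    h.measurable_iterate (F := fun n p => lam n * inner ℝ (φ p.1) (p.2 - u))
    (C := (∑' k, lam k ^ 2) * (K * C)) (fun n => by fun_prop)
    (fun n x => integral_inner_eq_zero (hφ.2.2.integrable one_le_two) h0 (lam n) (x - u))
    (fun n => (h.memLp_noise hφ n).1) (fun n => by
      calc _ ≤ ∑ k ∈ Finset.range n, lam k ^ 2 * (K * C) := by
            refine Finset.sum_le_sum fun k _ => (h.memLp_noise hφ k).2.trans ?_
            gcongr
            exact hC k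
        _ ≤ _ := by
            rw [← Finset.sum_mul]
            gcongr
            exact h.lam_sq.sum_le_tsum _ fun _ _ => sq_nonneg _)
  have hsel : ∀ᵐ ω ∂P, Summable fun n => lam n ^ 2 * ‖φ (ζ n ω)‖ ^ 2 := by
    refine ae_summable_of_sum_integral_le (C := (∑' k, lam k ^ 2) * K)
      (fun n ω => by positivity)
      (fun n => ((hφ.1.comp (h.noise_meas n)).norm.pow_const 2).const_mul _)
      (fun n => (h.integrable_sq_selection hφ.2.2 n).const_mul _) fun n => ?_
    simp only [integral_const_mul, h.integral_sq_selection hφ.1]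
    rw [← Finset.sum_mul]
    gcongr
    exact h.lam_sq.sum_le_tsum _ fun _ _ => sq_nonneg _
  filter_upwards [hnoise, hsel, h.ae_step_le hφ] with ω ⟨c, hc⟩ hs hstep
  set S : ℕ → ℝ := fun n => ∑ k ∈ Finset.range n, lam k * inner ℝ (φ (ζ k ω)) (X k ω - u) with hS
  set R : ℕ → ℝ := fun n => ∑ k ∈ Finset.range n, lam k ^ 2 * ‖φ (ζ k ω)‖ ^ 2 with hR
  have hRt : Tendsto R atTop (𝓝 _) := hs.tendsto_sum_tsum_nat
  have hD : Tendsto (fun n => 2 * S n - 2 * R n) atTop (𝓝 _) :=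
    (hc.const_mul 2).sub (hRt.const_mul 2)
  -- Compensating by the two convergent series S and R turns the perturbed decrease of the distance
  -- into a true one.
  have hanti : Antitone fun n => ‖X n ω - u‖ ^ 2 + (2 * S n - 2 * R n) := by
    refine antitone_nat_of_succ_le fun n => ?_
    simp only [hS, hR, Finset.sum_range_succ]
    have h1 := hstep n
    have h2 : 0 ≤ lam n ^ 2 * ‖yosida (A (ζ n ω)) (lam n) (X n ω)‖ ^ 2 / 2 := by positivity
    linarith
  obtain ⟨b, hb⟩ := hD.bddBelow_range
  have hbdd : BddBelow (Set.range fun n => ‖X n ω - u‖ ^ 2 + (2 * S n - 2 * R n)) := by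
    refine ⟨b, ?_⟩
    rintro _ ⟨n, rfl⟩
    have h1 := hb ⟨n, rfl⟩
    have h2 := sq_nonneg ‖X n ω - u‖
    dsimp only at h1 ⊢
    linarith
  have hlim := (tendsto_atTop_ciInf hanti hbdd).sub hD
  simp only [add_sub_cancel_right] at hlim
  exact ⟨_, hlim⟩

/-- Along almost every path, the sums of `lam k * ⟪∫ A_{lam k}(s, X k) dμ, X k - u⟫` are
bounded. -/
theorem ae_exists_abs_sum_le (h : IsProximalScheme μ P A lam ζ X) {z : H} {φ : E → H}
    (hφ : φ ∈ selections μ 2 fun s => A s z) (h0 : ∫ s, φ s ∂μ = 0) (u : H) :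
    ∀ᵐ ω ∂P, ∃ C : ℝ, ∀ n, |∑ k ∈ Finset.range n,
      lam k * inner ℝ (∫ s, yosida (A s) (lam k) (X k ω) ∂μ) (X k ω - u)| ≤ C := by
  obtain ⟨C, -, hC⟩ := h.exists_energy_bound hφ h0
  -- Truncation to a ball bounds the second moments by R² times the energy. Integer radii keep a
  -- common null set, and on a bounded path a large R makes the truncation inactive.
  have hnoise : ∀ᵐ ω ∂P, ∀ R : ℕ, ∃ c, Tendsto (fun n => ∑ k ∈ Finset.range n,
      ((Metric.closedBall u (R : ℝ)).indicator
        (fun x => lam k * inner ℝ (yosida (A (ζ k ω)) (lam k) x) (x - u)) (X k ω)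
      - ∫ s, (Metric.closedBall u (R : ℝ)).indicator
        (fun x => lam k * inner ℝ (yosida (A s) (lam k) x) (x - u)) (X k ω) ∂μ)) atTop (𝓝 c) := by
    refine ae_all_iff.2 fun R => ?_
    have hmeas : ∀ n, Measurable fun p : E × H => (Metric.closedBall u (R : ℝ)).indicator
        (fun x => lam n * inner ℝ (yosida (A p.1) (lam n) x) (x - u)) p.2 := by
      intro n
      have h1 : Measurable fun p : E × H =>
          lam n * inner ℝ (yosida (A p.1) (lam n) p.2) (p.2 - u) :=
        ((h.measurable_yosida n).inner (measurable_snd.sub_const u)).const_mul _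
      have h2 := h1.indicator
        (measurable_snd (α := E) (Metric.isClosed_closedBall (x := u) (ε := (R : ℝ))).measurableSet)
      convert h2 using 1
      funext p
      simp [Set.indicator]
    have hsq : ∀ n ω, ((Metric.closedBall u (R : ℝ)).indicator
        (fun x => lam n * inner ℝ (yosida (A (ζ n ω)) (lam n) x) (x - u)) (X n ω)) ^ 2 ≤
        (R : ℝ) ^ 2 * (lam n ^ 2 * ‖yosida (A (ζ n ω)) (lam n) (X n ω)‖ ^ 2) := by
      intro n ω
      by_cases hx : X n ω ∈ Metric.closedBall u (R : ℝ)
      · rw [Set.indicator_of_mem hx, mul_pow]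
        have h1 := abs_real_inner_le_norm (yosida (A (ζ n ω)) (lam n) (X n ω)) (X n ω - u)
        rw [mem_closedBall_iff_norm] at hx
        calc _ = lam n ^ 2 * |inner ℝ (yosida (A (ζ n ω)) (lam n) (X n ω)) (X n ω - u)| ^ 2 := by
              rw [sq_abs]
          _ ≤ lam n ^ 2 * (‖yosida (A (ζ n ω)) (lam n) (X n ω)‖ * R) ^ 2 := by
              gcongr
              exact h1.trans (by gcongr)
          _ = _ := by ring
      · rw [Set.indicator_of_notMem hx, zero_pow two_ne_zero]
        positivity
    have hmeas' := fun n => (hmeas n).comp ((h.noise_meas n).prodMk (h.measurable_iterate' n))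
    have hint := fun n => (h.integrable_sq_yosida hφ n).const_mul ((R : ℝ) ^ 2)
    have hint' := fun n => (hint n).mono' ((hmeas' n).pow_const 2).aestronglyMeasurable
      (Eventually.of_forall fun ω => by
        rw [Real.norm_of_nonneg (sq_nonneg _)]
        exact hsq n ω)
    refine ae_tendsto_sum_centered_noise h.noise_meas h.noise_law h.noise_indep
      h.measurable_iterate (f := fun n p => (Metric.closedBall u (R : ℝ)).indicator
        (fun x => lam n * inner ℝ (yosida (A p.1) (lam n) x) (x - u)) p.2)
      hmeas ?_ (fun n => (memLp_two_iff_integrable_sq (hmeas' n).aestronglyMeasurable).2 (hint' n))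
      (C := (R : ℝ) ^ 2 * C) fun n => ?_
    · intro n x
      by_cases hx : x ∈ Metric.closedBall u (R : ℝ)
      · simp only [Set.indicator_of_mem hx]
        exact ((h.memLp_yosida hφ n x).inner_const (x - u)).const_mul _
      · simp only [Set.indicator_of_notMem hx]
        exact memLp_const 0
    · refine le_trans ?_ (mul_le_mul_of_nonneg_left (hC n) (sq_nonneg _))
      rw [Finset.mul_sum]
      refine Finset.sum_le_sum fun k _ => ?_
      rw [← integral_const_mul]
      exact integral_mono (hint' k) (hint k) (hsq k)
  filter_upwards [hnoise, h.ae_summable_sq_yosida hφ h0, h.ae_tendsto_norm_sq hφ h0]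
    with ω hω hsum ⟨c, hc⟩
  obtain ⟨b, hb⟩ := hc.bddAbove_range
  have hb0 : 0 ≤ b := (sq_nonneg _).trans (hb ⟨0, rfl⟩)
  obtain ⟨R, hR⟩ := exists_nat_ge (√b + ‖z - u‖)
  have hbd : ∀ n, ‖X n ω - u‖ ≤ R := by
    intro n
    have h1 : ‖X n ω - z‖ ≤ √b := Real.le_sqrt_of_sq_le (hb ⟨n, rfl⟩)
    calc _ = ‖(X n ω - z) + (z - u)‖ := by congr 1; abel
      _ ≤ _ := (norm_add_le _ _).trans (by linarith)
  have hmem : ∀ n, X n ω ∈ Metric.closedBall u (R : ℝ) := fun n =>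
    mem_closedBall_iff_norm.2 (hbd n)
  obtain ⟨d, hd⟩ := hω R
  have hE : ∀ k, ∫ s, lam k * inner ℝ (yosida (A s) (lam k) (X k ω)) (X k ω - u) ∂μ =
      lam k * inner ℝ (∫ s, yosida (A s) (lam k) (X k ω) ∂μ) (X k ω - u) := by
    intro k
    rw [integral_const_mul, real_inner_comm,
      ← integral_inner ((h.memLp_yosida hφ k (X k ω)).integrable one_le_two)]
    simp only [real_inner_comm]
  simp only [Set.indicator_of_mem (hmem _), hE, Finset.sum_sub_distrib] at hd
  obtain ⟨D, hD⟩ := hd.norm.bddAbove_range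
  -- The sampled sums telescope through the squared distances, hence are bounded on this path; `hD`
  -- transfers the bound to the mean operators.
  have htel : ∀ n, 2 * ∑ k ∈ Finset.range n,
      lam k * inner ℝ (yosida (A (ζ k ω)) (lam k) (X k ω)) (X k ω - u) =
      ‖X 0 ω - u‖ ^ 2 - ‖X n ω - u‖ ^ 2 + ∑ k ∈ Finset.range n,
        lam k ^ 2 * ‖yosida (A (ζ k ω)) (lam k) (X k ω)‖ ^ 2 := by
    intro n
    induction n with
    | zero => simp
    | succ n ih =>
      rw [Finset.sum_range_succ, mul_add, ih, Finset.sum_range_succ, h.step,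
        norm_sq_resolventMap_sub (h.lam_pos n)]
      ring
  set T := ∑' k, lam k ^ 2 * ‖yosida (A (ζ k ω)) (lam k) (X k ω)‖ ^ 2
  refine ⟨D + ((R : ℝ) ^ 2 + T), fun n => ?_⟩
  have h1 : |_| ≤ D := hD ⟨n, rfl⟩
  have h2 := htel n
  have h3 : ∑ k ∈ Finset.range n, lam k ^ 2 * ‖yosida (A (ζ k ω)) (lam k) (X k ω)‖ ^ 2 ≤ T :=
    hsum.sum_le_tsum _ fun _ _ => by positivity
  have h4 : 0 ≤ ∑ k ∈ Finset.range n, lam k ^ 2 * ‖yosida (A (ζ k ω)) (lam k) (X k ω)‖ ^ 2 :=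
    Finset.sum_nonneg fun _ _ => by positivity
  have h5 : ‖X 0 ω - u‖ ^ 2 ≤ (R : ℝ) ^ 2 := by gcongr; exact hbd 0
  have h6 : ‖X n ω - u‖ ^ 2 ≤ (R : ℝ) ^ 2 := by gcongr; exact hbd n
  have h7 := sq_nonneg ‖X 0 ω - u‖
  have h8 := sq_nonneg ‖X n ω - u‖
  rw [abs_le] at h1 ⊢
  constructor <;> linarith

end IsProximalScheme

end Scheme

/-! ### Weighted averages. -/

section WeightedAvg

variable {H : Type*} [NormedAddCommGroup H] [InnerProductSpace ℝ H] {lam : ℕ → ℝ}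

theorem sum_Icc_one_eq_sum_range {M : Type*} [AddCommMonoid M] (f : ℕ → M) (n : ℕ) :
    ∑ k ∈ Finset.Icc 1 n, f k = ∑ k ∈ Finset.range n, f (k + 1) := by
  induction n with
  | zero => simp
  | succ n ih => rw [Finset.sum_Icc_succ_top (by omega), ih, Finset.sum_range_succ]

theorem sum_Icc_one_pos (hpos : ∀ n, 0 < lam n) {n : ℕ} (hn : 1 ≤ n) :
    0 < ∑ k ∈ Finset.Icc 1 n, lam k :=
  Finset.sum_pos (fun k _ => hpos k) ⟨1, Finset.mem_Icc.2 ⟨le_rfl, hn⟩⟩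

theorem tendsto_sum_Icc_one_atTop (hpos : ∀ n, 0 < lam n) (hsum : ¬ Summable lam) :
    Tendsto (fun n => ∑ k ∈ Finset.Icc 1 n, lam k) atTop atTop := by
  simp only [sum_Icc_one_eq_sum_range]
  exact (not_summable_iff_tendsto_nat_atTop_of_nonneg fun n => (hpos (n + 1)).le).1
    (mt (summable_nat_add_iff 1).1 hsum)

/-- Weighted Cesàro: partial sums of terms o(λ_n) are negligible against the divergent partial sums
of λ_n. -/
theorem tendsto_weightedAvg (hpos : ∀ n, 0 < lam n) (hsum : ¬ Summable lam) {b : ℕ → ℝ} {L : ℝ}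
    (hb : Tendsto b atTop (𝓝 L)) : Tendsto (weightedAvg lam b) atTop (𝓝 L) := by
  have hinf := tendsto_sum_Icc_one_atTop hpos hsum
  simp only [sum_Icc_one_eq_sum_range] at hinf
  have h0 : Tendsto (fun n => b (n + 1) - L) atTop (𝓝 0) := by
    simpa using ((tendsto_add_atTop_iff_nat 1).2 hb).sub_const L
  have h1 : (fun n => lam (n + 1) * (b (n + 1) - L)) =o[atTop] fun n => lam (n + 1) := by
    simpa using (Asymptotics.isBigO_refl (fun n => lam (n + 1)) atTop).mul_isLittleO
      ((Asymptotics.isLittleO_one_iff ℝ).2 h0)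
  have h2 := (h1.sum_range (fun n => (hpos (n + 1)).le) hinf).tendsto_div_nhds_zero
  have h3 := h2.add_const L
  rw [zero_add] at h3
  refine h3.congr' ?_
  filter_upwards [eventually_ge_atTop 1] with n hn
  have hp := sum_Icc_one_pos hpos hn
  rw [sum_Icc_one_eq_sum_range] at hp
  simp only [weightedAvg, smul_eq_mul, mul_sub, Finset.sum_sub_distrib, ← Finset.sum_mul,
    sum_Icc_one_eq_sum_range]
  field_simp
  ring

theorem inner_weightedAvg (w : H) (x : ℕ → H) (n : ℕ) :
    inner ℝ w (weightedAvg lam x n) = weightedAvg lam (fun k => inner ℝ w (x k)) n := by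
  simp [weightedAvg, real_inner_smul_right, inner_sum]

theorem weightedAvg_mono (hpos : ∀ n, 0 < lam n) {b c : ℕ → ℝ} (h : ∀ k, b k ≤ c k) (n : ℕ) :
    weightedAvg lam b n ≤ weightedAvg lam c n := by
  have h0 : 0 ≤ ∑ k ∈ Finset.Icc 1 n, lam k := Finset.sum_nonneg fun k _ => (hpos k).le
  simp only [weightedAvg, smul_eq_mul]
  gcongr with k
  · exact (hpos k).le
  · exact h k

theorem weightedAvg_add {b c : ℕ → ℝ} (n : ℕ) :
    weightedAvg lam (fun k => b k + c k) n = weightedAvg lam b n + weightedAvg lam c n := by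
  simp only [weightedAvg, smul_eq_mul, mul_add, Finset.sum_add_distrib]

theorem weightedAvg_const_mul (r : ℝ) {b : ℕ → ℝ} (n : ℕ) :
    weightedAvg lam (fun k => r * b k) n = r * weightedAvg lam b n := by
  simp only [weightedAvg, smul_eq_mul, mul_left_comm _ r, ← Finset.mul_sum]

theorem weightedAvg_const (hpos : ∀ n, 0 < lam n) {V : Type*} [AddCommGroup V] [Module ℝ V] (r : V)
    {n : ℕ} (hn : 1 ≤ n) : weightedAvg lam (fun _ => r) n = r := by
  rw [weightedAvg, ← Finset.sum_smul, smul_smul,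
    inv_mul_cancel₀ (sum_Icc_one_pos hpos hn).ne', one_smul]

theorem integral_weightedAvg {E : Type*} [MeasurableSpace E] {ν : Measure E} {g : ℕ → E → ℝ}
    (hg : ∀ k, Integrable (g k) ν) (n : ℕ) :
    ∫ s, weightedAvg lam (fun k => g k s) n ∂ν = weightedAvg lam (fun k => ∫ s, g k s ∂ν) n := by
  simp only [weightedAvg, smul_eq_mul]
  rw [integral_const_mul, integral_finsetSum _ fun k _ => (hg k).const_mul _]
  simp only [integral_const_mul]

theorem integrable_weightedAvg {E : Type*} [MeasurableSpace E] {ν : Measure E} {g : ℕ → E → ℝ}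
    (hg : ∀ k, Integrable (g k) ν) (n : ℕ) :
    Integrable (fun s => weightedAvg lam (fun k => g k s) n) ν := by
  simp only [weightedAvg, smul_eq_mul]
  exact (integrable_finsetSum _ fun k _ => (hg k).const_mul _).const_mul _

theorem norm_weightedAvg_sub_le (hpos : ∀ n, 0 < lam n) {x : ℕ → H} {u : H} {R : ℝ}
    (hx : ∀ k, ‖x k - u‖ ≤ R) {n : ℕ} (hn : 1 ≤ n) : ‖weightedAvg lam x n - u‖ ≤ R := by
  have hp := sum_Icc_one_pos hpos hn
  have e : weightedAvg lam x n - u =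
      (∑ k ∈ Finset.Icc 1 n, lam k)⁻¹ • ∑ k ∈ Finset.Icc 1 n, lam k • (x k - u) := by
    simp only [smul_sub, Finset.sum_sub_distrib, ← Finset.sum_smul]
    rw [smul_smul, inv_mul_cancel₀ hp.ne', one_smul, weightedAvg]
  rw [e, norm_smul, norm_inv, Real.norm_of_nonneg hp.le, inv_mul_le_iff₀ hp, Finset.sum_mul]
  refine norm_sum_le_of_le _ fun k _ => ?_
  rw [norm_smul, Real.norm_of_nonneg (hpos k).le]
  exact mul_le_mul_of_nonneg_left (hx k) (hpos k).le

end WeightedAvg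

/-! ### Uniform integrability and integrals over small sets. -/

section UniformIntegrability

variable {E ι : Type*} [MeasurableSpace E] {μ : Measure E}

/-- Uniformly integrable families have uniformly small integrals over small sets. -/
theorem UnifIntegrableFamily.exists_pos {f : ι → E → ℝ} (hf : UnifIntegrableFamily μ f)
    (hm : ∀ i, Measurable (f i)) {ε : ℝ≥0∞} (hε : 0 < ε) :
    ∃ δ : ℝ≥0∞, 0 < δ ∧ ∀ B, MeasurableSet B → μ B ≤ δ →
      ∀ i, ∫⁻ s in B, ENNReal.ofReal (f i s) ∂μ ≤ ε := by
  have hε2 : 0 < ε / 2 := ENNReal.half_pos hε.ne'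
  obtain ⟨a, ha, ha1⟩ := ((hf.eventually (ge_mem_nhds hε2)).and (eventually_ge_atTop 1)).exists
  have ha0 : ENNReal.ofReal a ≠ 0 := by
    rw [Ne, ENNReal.ofReal_eq_zero]; linarith
  -- On B the part where f > a contributes at most ε/2 by the choice of a, and the rest at most a
  -- μ(B) ≤ ε/2.
  refine ⟨ε / 2 / ENNReal.ofReal a, ENNReal.div_pos hε2.ne' ENNReal.ofReal_ne_top,
    fun B hB hμ i => ?_⟩
  have hS : MeasurableSet {s | a < f i s} := measurableSet_lt measurable_const (hm i)
  rw [← lintegral_inter_add_sdiff _ B hS, ← ENNReal.add_halves ε]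
  refine add_le_add ?_ ?_
  · exact (lintegral_mono_set Set.inter_subset_right).trans
      ((le_iSup (fun i => ∫⁻ s in {s | a < f i s}, ENNReal.ofReal (f i s) ∂μ) i).trans ha)
  · calc _ ≤ ∫⁻ _ in B \ {s | a < f i s}, ENNReal.ofReal a ∂μ := by
          refine setLIntegral_mono measurable_const fun s hs => ENNReal.ofReal_le_ofReal ?_
          exact not_lt.1 hs.2
      _ ≤ ENNReal.ofReal a * μ B := by
          rw [setLIntegral_const]
          gcongr
          exact Set.sdiff_subset
      _ ≤ ε / 2 := by
          refine (mul_le_mul_right hμ _).trans ?_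
          rw [ENNReal.mul_div_cancel ha0 ENNReal.ofReal_ne_top]

theorem UnifIntegrableFamily.congr_ae {f g : ι → E → ℝ} (hf : UnifIntegrableFamily μ f)
    (h : ∀ i, f i =ᵐ[μ] g i) : UnifIntegrableFamily μ g := by
  unfold UnifIntegrableFamily at hf ⊢
  convert hf using 4 with a i
  have h1 : {s | a < g i s} =ᵐ[μ] {s | a < f i s} := by
    filter_upwards [h i] with s hs
    exact congrArg (a < ·) hs.symm
  rw [setLIntegral_congr h1]
  refine lintegral_congr_ae (ae_restrict_of_ae ?_)
  filter_upwards [h i] with s hs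
  rw [hs]

end UniformIntegrability

/-! ### Tails of an integrable selection. -/

section Tail

variable {E H : Type*} [MeasurableSpace E] {μ : Measure E} [IsFiniteMeasure μ]
  [NormedAddCommGroup H] [MeasurableSpace H] [OpensMeasurableSpace H]

/-- The sets ‖φ‖ > c decrease to the empty set, so both quantities tend to zero by continuity from
above. -/
theorem exists_nat_tail_small {φ : E → H} (hφm : Measurable φ) (hφ : Integrable φ μ)
    {ε : ℝ} (hε : 0 < ε) {δ : ℝ≥0∞} (hδ : 0 < δ) :
    ∃ c : ℕ, μ {s | (c : ℝ) < ‖φ s‖} ≤ δ ∧ ∫ s in {s | (c : ℝ) < ‖φ s‖}, ‖φ s‖ ∂μ ≤ ε := by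
  have hB : ∀ c : ℕ, MeasurableSet {s | (c : ℝ) < ‖φ s‖} := fun c =>
    measurableSet_lt measurable_const hφm.norm
  have hanti : Antitone fun c : ℕ => {s | (c : ℝ) < ‖φ s‖} := fun c d hcd s hs =>
    (Nat.cast_le.2 hcd).trans_lt (show (d : ℝ) < ‖φ s‖ from hs)
  have hempty : ⋂ c : ℕ, {s | (c : ℝ) < ‖φ s‖} = ∅ := by
    refine Set.eq_empty_of_forall_notMem fun s hs => ?_
    obtain ⟨c, hc⟩ := exists_nat_ge ‖φ s‖
    exact absurd (Set.mem_iInter.1 hs c) (not_lt.2 hc)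
  have h1 := tendsto_measure_iInter_atTop (μ := μ) (fun c => (hB c).nullMeasurableSet) hanti
    ⟨0, measure_ne_top _ _⟩
  have h2 := tendsto_setIntegral_of_antitone (μ := μ) hB hanti
    ⟨0, hφ.norm.integrableOn⟩
  rw [hempty, measure_empty] at h1
  rw [hempty, setIntegral_empty] at h2
  obtain ⟨c, hc1, hc2⟩ :=
    ((h1.eventually (ge_mem_nhds hδ)).and (h2.eventually (ge_mem_nhds hε))).exists
  exact ⟨c, hc1, hc2⟩

end Tail

/-! ### The limiting variational inequality. -/

section Ergodic

variable {H : Type*} [NormedAddCommGroup H] [InnerProductSpace ℝ H] [CompleteSpace H]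
  [MeasurableSpace H] [BorelSpace H]
  {E : Type*} [MeasurableSpace E] {μ : Measure E} [IsProbabilityMeasure μ]
  {A : E → H → Set H} {lam : ℕ → ℝ}

/-- Along a bounded sequence with property `UI-bar` the averages satisfy, in the limit, the
variational inequality of the mean operator at any point of its graph. -/
theorem eventually_inner_weightedAvg_le (hA : ∀ s, IsMaximalMonotoneOp (A s))
    (hpos : ∀ n, 0 < lam n) (hsum : ¬ Summable lam) {x : ℕ → H}
    (hmeas : ∀ k, Measurable fun s => yosida (A s) (lam k) (x k))
    (hL2 : ∀ k, MemLp (fun s => yosida (A s) (lam k) (x k)) 2 μ)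
    (hsq : Summable fun k => lam k ^ 2 * ∫ s, ‖yosida (A s) (lam k) (x k)‖ ^ 2 ∂μ)
    (hUI : PropertyUIBar μ A lam x) {u : H} {R : ℝ} (hR : ∀ k, ‖x k - u‖ ≤ R) {C : ℝ}
    (hC : ∀ n, |∑ k ∈ Finset.range n,
      lam k * inner ℝ (∫ s, yosida (A s) (lam k) (x k) ∂μ) (x k - u)| ≤ C)
    {φ : E → H} (hφ : φ ∈ selections μ 1 fun s => A s u) {ε : ℝ} (hε : 0 < ε) :
    ∀ᶠ n in atTop, inner ℝ (∫ s, φ s ∂μ) (weightedAvg lam x n - u) ≤ ε := by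
  obtain ⟨hφm, hφA, hφ1⟩ := hφ
  have hφi : Integrable φ μ := memLp_one_iff_integrable.1 hφ1
  set v := ∫ s, φ s ∂μ with hv
  set a : ℕ → E → H := fun k s => yosida (A s) (lam k) (x k) with ha
  have hai : ∀ k, Integrable (a k) μ := fun k => (hL2 k).integrable one_le_two
  have hR0 : 0 ≤ R := (norm_nonneg _).trans (hR 0)
  -- Four error terms of size ε/4 each; R + 1 keeps the denominator positive when R = 0.
  set η := ε / (4 * (R + 1)) with hη
  have hη0 : 0 < η := by positivity
  have hRη : R * η ≤ ε / 4 := by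
    rw [hη, mul_div_assoc', div_le_div_iff₀ (by positivity) (by norm_num)]
    nlinarith
  have hfm : ∀ n : ℕ+, Measurable fun s => weightedAvg lam (fun k => ‖a k s‖) n := by
    intro n
    simp only [weightedAvg, smul_eq_mul]
    exact (Finset.measurable_fun_sum _ fun k _ => (hmeas k).norm.const_mul _).const_mul _
  obtain ⟨δ, hδ, hδB⟩ := UnifIntegrableFamily.exists_pos hUI hfm (ENNReal.ofReal_pos.2 hη0)
  obtain ⟨c, hcμ, hcφ⟩ := exists_nat_tail_small hφm hφi hη0 hδ
  set B := {s | (c : ℝ) < ‖φ s‖} with hB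
  have hBm : MeasurableSet B := measurableSet_lt measurable_const hφm.norm
  -- Off B monotonicity costs λ_k‖φ‖‖a_k‖ with ‖φ‖ ≤ c. On B that product need not be integrable
  -- uniformly, so monotonicity is dropped and Cauchy–Schwarz with ‖x_k - u‖ ≤ R is used.
  have hpt : ∀ k, ∀ᵐ s ∂μ, inner ℝ (x k - u) (φ s) ≤ inner ℝ (x k - u) (a k s)
      + c * (lam k * ‖a k s‖) + R * (B.indicator (fun s => ‖φ s‖) s)
      + R * (B.indicator (fun s => ‖a k s‖) s) := by
    intro k
    filter_upwards [hφA] with s hs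
    rw [real_inner_comm (φ s), real_inner_comm (a k s)]
    by_cases hsB : s ∈ B
    · rw [Set.indicator_of_mem hsB, Set.indicator_of_mem hsB]
      have h1 := (le_abs_self _).trans (abs_real_inner_le_norm (φ s) (x k - u))
      have h2 := (neg_le_abs _).trans (abs_real_inner_le_norm (a k s) (x k - u))
      have h3 : ‖φ s‖ * ‖x k - u‖ ≤ ‖φ s‖ * R := by gcongr; exact hR k
      have h4 : ‖a k s‖ * ‖x k - u‖ ≤ ‖a k s‖ * R := by gcongr; exact hR k
      have h5 : 0 ≤ c * (lam k * ‖a k s‖) :=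
        mul_nonneg (Nat.cast_nonneg c) (mul_nonneg (hpos k).le (norm_nonneg _))
      linarith
    · rw [Set.indicator_of_notMem hsB, Set.indicator_of_notMem hsB]
      have h1 := (hA s).inner_yosida_ge (hpos k) hs (x k)
      have h2 : ‖φ s‖ ≤ c := not_lt.1 hsB
      have h3 : lam k * (‖φ s‖ * ‖a k s‖) ≤ c * (lam k * ‖a k s‖) := by
        rw [mul_left_comm]
        exact mul_le_mul_of_nonneg_right h2 (mul_nonneg (hpos k).le (norm_nonneg _))
      have e : a k s = yosida (A s) (lam k) (x k) := rfl
      rw [e] at h3 ⊢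
      linarith
  have hint : ∀ k, inner ℝ v (x k) + (- inner ℝ v u) ≤
      inner ℝ (∫ s, a k s ∂μ) (x k - u) + c * (lam k * ∫ s, ‖a k s‖ ∂μ)
      + R * (∫ s in B, ‖φ s‖ ∂μ) + R * ∫ s in B, ‖a k s‖ ∂μ := by
    intro k
    have i0 := hφi.const_inner (𝕜 := ℝ) (x k - u)
    have i1 := (hai k).const_inner (𝕜 := ℝ) (x k - u)
    have i2 := ((hai k).norm.const_mul (lam k)).const_mul (c : ℝ)
    have i3 := (hφi.norm.indicator hBm).const_mul R
    have i4 := ((hai k).norm.indicator hBm).const_mul R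
    have h := integral_mono_ae i0 (((i1.add i2).add i3).add i4) (hpt k)
    rw [integral_add' ((i1.add i2).add i3) i4, integral_add' (i1.add i2) i3,
      integral_add' i1 i2, integral_const_mul, integral_const_mul, integral_const_mul,
      integral_const_mul, integral_indicator hBm, integral_indicator hBm, integral_inner hφi,
      integral_inner (hai k), real_inner_comm v, real_inner_comm (∫ s, a k s ∂μ),
      inner_sub_right v] at h
    rw [← sub_eq_add_neg]
    exact h
  have hnull : Tendsto (fun k => lam k * ∫ s, ‖a k s‖ ∂μ) atTop (𝓝 0) := by
    have h1 : Tendsto (fun k => √(lam k ^ 2 * ∫ s, ‖a k s‖ ^ 2 ∂μ)) atTop (𝓝 0) := by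
      simpa using hsq.tendsto_atTop_zero.sqrt
    refine squeeze_zero (fun k => mul_nonneg (hpos k).le (integral_nonneg fun _ => norm_nonneg _))
      (fun k => Real.le_sqrt_of_sq_le ?_) h1
    rw [mul_pow]
    gcongr
    have h2 := variance_nonneg (fun s => ‖a k s‖) μ
    rw [variance_eq_sub (hL2 k).norm] at h2
    simpa using h2
  have hT2 := (tendsto_weightedAvg hpos hsum hnull).const_mul (c : ℝ)
  have hT1 : Tendsto (fun n => (∑ k ∈ Finset.Icc 1 n, lam k)⁻¹ * (2 * C)) atTop (𝓝 0) := by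
    simpa using (tendsto_sum_Icc_one_atTop hpos hsum).inv_tendsto_atTop.mul_const (2 * C)
  rw [mul_zero] at hT2
  have hε4 : 0 < ε / 4 := by positivity
  filter_upwards [eventually_ge_atTop 1, hT2.eventually (ge_mem_nhds hε4),
    hT1.eventually (ge_mem_nhds hε4)] with n hn h2 h1
  have hle := weightedAvg_mono hpos hint n
  rw [weightedAvg_add, weightedAvg_add, weightedAvg_add, weightedAvg_add,
    weightedAvg_const hpos _ hn, weightedAvg_const hpos _ hn, weightedAvg_const_mul,
    weightedAvg_const_mul, ← inner_weightedAvg,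
    ← integral_weightedAvg fun k => (hai k).norm.integrableOn] at hle
  rw [inner_sub_right]
  have h3 : R * ∫ s in B, ‖φ s‖ ∂μ ≤ ε / 4 := (mul_le_mul_of_nonneg_left hcφ hR0).trans hRη
  have h4 : R * ∫ s in B, weightedAvg lam (fun k => ‖a k s‖) n ∂μ ≤ ε / 4 := by
    refine (mul_le_mul_of_nonneg_left ?_ hR0).trans hRη
    -- Property UI-bar enters here: it concerns only the averages over k, which is enough after
    -- averaging `hint`.
    have h := hδB B hBm hcμ ⟨n, hn⟩
    rw [← ofReal_integral_eq_lintegral_ofReal, ENNReal.ofReal_le_ofReal_iff hη0.le] at h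
    · exact h
    · exact integrable_weightedAvg (fun k => (hai k).norm.integrableOn) n
    · refine Eventually.of_forall fun s => ?_
      have h0 : 0 ≤ ∑ k ∈ Finset.Icc 1 n, lam k := Finset.sum_nonneg fun k _ => (hpos k).le
      exact mul_nonneg (inv_nonneg.2 h0)
        (Finset.sum_nonneg fun k _ => mul_nonneg (hpos k).le (norm_nonneg _))
  have h5 : weightedAvg lam (fun k => inner ℝ (∫ s, a k s ∂μ) (x k - u)) n ≤ ε / 4 := by
    refine le_trans ?_ h1
    simp only [weightedAvg, smul_eq_mul]
    refine mul_le_mul_of_nonneg_left ?_ (inv_nonneg.2 (sum_Icc_one_pos hpos hn).le)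
    -- The averages start at k = 1, so the k = 0 term is subtracted from the bounded sum; each is at
    -- most C in absolute value, hence 2C.
    have e := Finset.sum_range_succ'
      (fun k => lam k * inner ℝ (∫ s, a k s ∂μ) (x k - u)) n
    have hC1 := hC 1
    have hC2 := hC (n + 1)
    rw [Finset.sum_range_one] at hC1
    rw [sum_Icc_one_eq_sum_range]
    rw [abs_le] at hC1 hC2
    linarith [hC1.1, hC2.2]
  linarith

end Ergodic

/-! ### Weak convergence and Opial's lemma for averages. -/

section WeakConvergence

variable {H : Type*} [NormedAddCommGroup H] [InnerProductSpace ℝ H] [CompleteSpace H]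

/-- Bounded sequences converge weakly along ultrafilters. -/
theorem exists_weak_limit_ultrafilter {ι : Type*} (U : Ultrafilter ι) {y : ι → H} {R : ℝ}
    (hy : ∀ᶠ i in U, ‖y i‖ ≤ R) :
    ∃ z : H, ∀ w, Tendsto (fun i => inner ℝ w (y i)) U (𝓝 (inner ℝ w z)) := by
  let g : ι → WeakDual ℝ H := fun i =>
    StrongDual.toWeakDual (InnerProductSpace.toDual ℝ H (y i))
  have hK := WeakDual.isCompact_closedBall (𝕜 := ℝ) (E := H) 0 R
  obtain ⟨f, -, hf⟩ := isCompact_iff_ultrafilter_le_nhds.1 hK (U.map g) (by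
    rw [le_principal_iff]
    change ∀ᶠ i in (U : Filter ι), _
    filter_upwards [hy] with i hi
    simpa [g] using hi)
  refine ⟨(InnerProductSpace.toDual ℝ H).symm (WeakDual.toStrongDual f), fun w => ?_⟩
  have h1 : Tendsto (fun i => g i w) U (𝓝 (f w)) :=
    ((WeakDual.eval_continuous w).tendsto f).comp hf
  have e1 : ∀ i, g i w = inner ℝ w (y i) := fun i => real_inner_comm _ _
  have e2 : f w = inner ℝ w ((InnerProductSpace.toDual ℝ H).symm (WeakDual.toStrongDual f)) := by
    rw [real_inner_comm, InnerProductSpace.toDual_symm_apply]; rfl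
  rw [← e2]
  simpa only [e1] using h1

/-- By the Riesz representation, testing against inner products tests against every continuous
functional. -/
theorem tendsto_toWeakSpace_iff {ι : Type*} {l : Filter ι} {y : ι → H} {z : H} :
    Tendsto (fun i => toWeakSpace ℝ H (y i)) l (𝓝 (toWeakSpace ℝ H z)) ↔
      ∀ w, Tendsto (fun i => inner ℝ w (y i)) l (𝓝 (inner ℝ w z)) := by
  have hinj : Function.Injective ((topDualPairing ℝ H).flip) := by
    intro a b hab
    refine ext_inner_left ℝ fun w => ?_
    exact DFunLike.congr_fun hab (InnerProductSpace.toDual ℝ H w)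
  have h := WeakBilin.tendsto_iff_forall_eval_tendsto (topDualPairing ℝ H).flip hinj (l := l)
    (f := fun i => toWeakSpace ℝ H (y i)) (x := toWeakSpace ℝ H z)
  refine h.trans ⟨fun h w => h (InnerProductSpace.toDual ℝ H w), fun h f => ?_⟩
  have := h ((InnerProductSpace.toDual ℝ H).symm f)
  simp only [InnerProductSpace.toDual_symm_apply] at this
  exact this

/-- Opial's lemma for weighted averages: if the distances to a dense subset `D` of `Z` converge
and the weak cluster points of the averages lie in `Z`, then the averages converge weakly. -/
theorem exists_tendsto_weightedAvg {lam : ℕ → ℝ} (hpos : ∀ n, 0 < lam n) (hsum : ¬ Summable lam)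
    {x : ℕ → H} {Z D : Set H} (hD : Z ⊆ closure D) {R : ℝ} (hR : ∀ n, ‖x n‖ ≤ R)
    (hdist : ∀ d ∈ D, ∃ c, Tendsto (fun n => ‖x n - d‖ ^ 2) atTop (𝓝 c))
    (hcluster : ∀ (U : Ultrafilter ℕ) (z : H), (U : Filter ℕ) ≤ atTop →
      (∀ w, Tendsto (fun n => inner ℝ w (weightedAvg lam x n)) U (𝓝 (inner ℝ w z))) → z ∈ Z) :
    ∃ z ∈ Z, Tendsto (fun n => toWeakSpace ℝ H (weightedAvg lam x n)) atTop
      (𝓝 (toWeakSpace ℝ H z)) := by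
  have hbd : ∀ᶠ n in atTop, ‖weightedAvg lam x n‖ ≤ R := by
    filter_upwards [eventually_ge_atTop 1] with n hn
    simpa using norm_weightedAvg_sub_le hpos (x := x) (u := 0) (R := R) (by simpa using hR) hn
  have hlim : ∀ U : Ultrafilter ℕ, (U : Filter ℕ) ≤ atTop → ∃ z ∈ Z,
      ∀ w, Tendsto (fun n => inner ℝ w (weightedAvg lam x n)) U (𝓝 (inner ℝ w z)) := by
    intro U hU
    obtain ⟨z, hz⟩ := exists_weak_limit_ultrafilter U (hU hbd)
    exact ⟨z, hcluster U z hU hz, hz⟩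
  -- The difference of the squared distances to d and d' is affine in x n, so ⟨d - d', x n⟩
  -- converges and its averages follow.
  have hdiff : ∀ d ∈ D, ∀ d' ∈ D, ∃ c,
      Tendsto (fun n => inner ℝ (d - d') (weightedAvg lam x n)) atTop (𝓝 c) := by
    intro d hd d' hd'
    obtain ⟨c, hc⟩ := hdist d hd
    obtain ⟨c', hc'⟩ := hdist d' hd'
    refine ⟨(c' - c + (‖d‖ ^ 2 - ‖d'‖ ^ 2)) / 2, ?_⟩
    simp only [inner_weightedAvg]
    refine tendsto_weightedAvg hpos hsum
      (((hc'.sub hc).add_const (‖d‖ ^ 2 - ‖d'‖ ^ 2)).div_const 2 |>.congr fun n => ?_)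
    rw [norm_sub_sq_real, norm_sub_sq_real, inner_sub_left, real_inner_comm d,
      real_inner_comm d']
    ring
  have huniq : ∀ (U U' : Ultrafilter ℕ) (z z' : H), (U : Filter ℕ) ≤ atTop →
      (U' : Filter ℕ) ≤ atTop → z ∈ Z → z' ∈ Z →
      (∀ w, Tendsto (fun n => inner ℝ w (weightedAvg lam x n)) U (𝓝 (inner ℝ w z))) →
      (∀ w, Tendsto (fun n => inner ℝ w (weightedAvg lam x n)) U' (𝓝 (inner ℝ w z'))) →
      z = z' := by
    intro U U' z z' hU hU' hz hz' ht ht'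
    have h1 : ∀ d ∈ D, ∀ d' ∈ D, inner ℝ (d - d') (z - z') = 0 := by
      intro d hd d' hd'
      obtain ⟨c, hc⟩ := hdiff d hd d' hd'
      rw [inner_sub_right, tendsto_nhds_unique (ht (d - d')) (hc.mono_left hU),
        tendsto_nhds_unique (ht' (d - d')) (hc.mono_left hU'), sub_self]
    -- Density replaces d' by z', then d by z, so that z - z' is orthogonal to itself.
    have h2 : ∀ d ∈ D, inner ℝ (d - z') (z - z') = 0 := by
      intro d hd
      have hcl : IsClosed {e : H | inner ℝ (d - e) (z - z') = (0 : ℝ)} :=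
        isClosed_eq (by fun_prop) continuous_const
      exact closure_minimal (fun e he => h1 d hd e he) hcl (hD hz')
    have h3 : inner ℝ (z - z') (z - z') = (0 : ℝ) := by
      have hcl : IsClosed {e : H | inner ℝ (e - z') (z - z') = (0 : ℝ)} :=
        isClosed_eq (by fun_prop) continuous_const
      exact closure_minimal (fun e he => h2 e he) hcl (hD hz)
    exact sub_eq_zero.1 (inner_self_eq_zero.1 h3)
  obtain ⟨z, hzZ, hz⟩ := hlim (hyperfilter ℕ) Nat.hyperfilter_le_atTop
  refine ⟨z, hzZ, tendsto_toWeakSpace_iff.2 fun w => ?_⟩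
  rw [tendsto_iff_ultrafilter]
  intro U hU
  obtain ⟨z', hz'Z, hz'⟩ := hlim U hU
  rw [huniq _ _ z z' Nat.hyperfilter_le_atTop hU hzZ hz'Z hz hz']
  exact hz' w

end WeakConvergence

/-! ### Assembly of the convergence theorem. -/

section Main

variable {H : Type*} [NormedAddCommGroup H] [InnerProductSpace ℝ H] [CompleteSpace H]
  [SecondCountableTopology H] [MeasurableSpace H] [BorelSpace H]
  {E Ω : Type*} [MeasurableSpace E] [MeasurableSpace Ω]
  {μ : Measure E} {P : Measure Ω} [IsProbabilityMeasure μ] [IsProbabilityMeasure P]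
  {A : E → H → Set H} {lam : ℕ → ℝ} {ζ : ℕ → Ω → E} {X : ℕ → Ω → H}

/-- Almost sure weak ergodic convergence of the stochastic proximal point algorithm when all the
operators are maximal monotone. -/
theorem IsProximalScheme.ae_exists_tendsto (h : IsProximalScheme μ P A lam ζ X)
    (hlam : ¬ Summable lam) (hmax : IsMaximalMonotoneOp (meanOp μ A))
    (hne : (zer (meanOp μ A)).Nonempty) (hsub : zer (meanOp μ A) ⊆ zerSel μ A 2) :
    ∀ᵐ ω ∂P, PropertyUIBar μ A lam (fun n => X n ω) → ∃ z ∈ zer (meanOp μ A),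
      Tendsto (fun n => toWeakSpace ℝ H (weightedAvg lam (fun k => X k ω) n)) atTop
        (𝓝 (toWeakSpace ℝ H z)) := by
  obtain ⟨D, hDZ, hDc, hDd⟩ :=
    (TopologicalSpace.IsSeparable.of_separableSpace
      (zer (meanOp μ A))).exists_countable_dense_subset
  -- The almost sure bounds depend on the test point of the graph; a countable dense part keeps one
  -- null set, and closedness of the inequality recovers the whole graph.
  obtain ⟨Γ, hΓG, hΓc, hΓd⟩ := (TopologicalSpace.IsSeparable.of_separableSpace
    {p : H × H | p.2 ∈ meanOp μ A p.1}).exists_countable_dense_subset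
  obtain ⟨z₀, hz₀⟩ := hne
  obtain ⟨φ₀, hφ₀, hφ₀0⟩ := hsub hz₀
  have hdist : ∀ᵐ ω ∂P, ∀ d ∈ D, ∃ c, Tendsto (fun n => ‖X n ω - d‖ ^ 2) atTop (𝓝 c) := by
    refine (ae_ball_iff hDc).2 fun d hd => ?_
    obtain ⟨φ, hφ, hφ0⟩ := hsub (hDZ hd)
    exact h.ae_tendsto_norm_sq hφ hφ0
  have hgraph : ∀ᵐ ω ∂P, ∀ p ∈ Γ, ∃ C : ℝ, ∀ n, |∑ k ∈ Finset.range n,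
      lam k * inner ℝ (∫ s, yosida (A s) (lam k) (X k ω) ∂μ) (X k ω - p.1)| ≤ C :=
    (ae_ball_iff hΓc).2 fun p _ => h.ae_exists_abs_sum_le hφ₀ hφ₀0 p.1
  filter_upwards [hdist, hgraph, h.ae_summable_integral_sq_yosida hφ₀ hφ₀0,
    h.ae_tendsto_norm_sq hφ₀ hφ₀0] with ω hdist hgraph hsq ⟨c, hc⟩ hUI
  obtain ⟨b, hb⟩ := hc.bddAbove_range
  have hbd : ∀ u n, ‖X n ω - u‖ ≤ √b + ‖z₀ - u‖ := by
    intro u n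
    have h1 : ‖X n ω - z₀‖ ≤ √b := Real.le_sqrt_of_sq_le (hb ⟨n, rfl⟩)
    calc _ = ‖(X n ω - z₀) + (z₀ - u)‖ := by congr 1; abel
      _ ≤ _ := (norm_add_le _ _).trans (by linarith)
  refine exists_tendsto_weightedAvg h.lam_pos hlam hDd
    (fun n => by simpa using hbd 0 n) hdist fun U z hU hz => ?_
  have hΓle : ∀ p ∈ Γ, inner ℝ p.2 (z - p.1) ≤ 0 := by
    intro p hp
    obtain ⟨φ, hφ, hφv⟩ := hΓG hp
    obtain ⟨C, hC⟩ := hgraph p hp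
    have hev := fun ε (hε : 0 < ε) => eventually_inner_weightedAvg_le (ε := ε) h.isMax h.lam_pos
      hlam (fun k => (h.measurable_yosida k).comp measurable_prodMk_right)
      (fun k => h.memLp_yosida hφ₀ k (X k ω)) hsq hUI (hbd p.1) hC hφ hε
    have ht : Tendsto (fun n => inner ℝ p.2 (weightedAvg lam (fun k => X k ω) n - p.1)) U
        (𝓝 (inner ℝ p.2 (z - p.1))) := by
      simp only [inner_sub_right]
      exact (hz p.2).sub_const _
    rw [hφv] at hev
    refine le_of_forall_pos_le_add fun ε hε => ?_
    rw [zero_add]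
    exact le_of_tendsto ht (hU (hev ε hε))
  have hcl : IsClosed {p : H × H | inner ℝ p.2 (z - p.1) ≤ (0 : ℝ)} :=
    isClosed_le (by fun_prop) continuous_const
  refine hmax.mem_of_forall fun a b hb => ?_
  have h1 : inner ℝ b (z - a) ≤ (0 : ℝ) :=
    closure_minimal (fun p hp => hΓle p hp) hcl (hΓd (show (a, b) ∈ {p : H × H | _} from hb))
  rw [zero_sub, inner_neg_left]
  linarith

end Main

end StochProx

theorem mainTheorem2
    {H : Type*} [NormedAddCommGroup H] [InnerProductSpace ℝ H] [CompleteSpace H]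
    [TopologicalSpace.SeparableSpace H] [MeasurableSpace H] [BorelSpace H]
    {E : Type*} [MeasurableSpace E] (μ : Measure E) [IsProbabilityMeasure μ] [μ.IsComplete]
    {Ω : Type*} [MeasurableSpace Ω] (P : Measure Ω) [IsProbabilityMeasure P]
    (A : E → H → Set H)
    (hA_max : ∀ᵐ s ∂μ, IsMaximalMonotoneOp (A s))
    (hA_meas : ∀ l : ℝ, 0 < l → ∀ x : H, Measurable fun s => resolventMap (A s) l x)
    (lam : ℕ → ℝ) (hlam_pos : ∀ n, 0 < lam n)
    (hlam_sq : Summable fun n => lam n ^ 2) (hlam_sum : ¬ Summable lam)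
    (ξ : ℕ → Ω → E) (hξ_meas : ∀ n, 1 ≤ n → Measurable (ξ n))
    (hξ_law : ∀ n, 1 ≤ n → P.map (ξ n) = μ)
    (hξ_indep : iIndepFun (fun n : ℕ => ξ (n + 1)) P)
    (h_mean_max : IsMaximalMonotoneOp (meanOp μ A))
    (h_zer_nonempty : (zer (meanOp μ A)).Nonempty)
    (h_zer_subset : zer (meanOp μ A) ⊆ zerSel μ A 2)
    (x₀ : H)
    (G : Set Ω) (hG : MeasurableSet G)
    (hG_UI : ∀ᵐ ω ∂P, ω ∈ G → PropertyUIBar μ A lam fun n => iterates A lam ξ x₀ n ω) :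
    ∀ᵐ ω ∂P, ω ∈ G → ∃ z ∈ zer (meanOp μ A),
      Tendsto
        (fun n => toWeakSpace ℝ H (weightedAvg lam (fun k => iterates A lam ξ x₀ k ω) n))
        atTop (𝓝 (toWeakSpace ℝ H z)) := by
  classical
  have : SecondCountableTopology H := UniformSpace.secondCountable_of_separable H
  -- replace `A s` by the zero operator on a measurable null set of exceptional `s`
  obtain ⟨N, hN, hNm, hN0⟩ := exists_measurable_superset_of_null (ae_iff.1 hA_max)
  let A' : E → H → Set H := fun s => if s ∈ N then fun _ => {0} else A s
  have hA'pos : ∀ s ∈ N, A' s = fun _ => {0} := fun s hs => if_pos hs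
  have hA'neg : ∀ s ∉ N, A' s = A s := fun s hs => if_neg hs
  have hae : ∀ᵐ s ∂μ, s ∉ N := measure_eq_zero_iff_ae_notMem.1 hN0
  have hA' : ∀ᵐ s ∂μ, A' s = A s := hae.mono hA'neg
  -- Selections ignore μ-null sets, so the mean operator and its zeroes are unchanged by the
  -- modification.
  have hsel : ∀ (p : ℝ≥0∞) (x : H),
      selections μ p (fun s => A' s x) = selections μ p fun s => A s x := by
    intro p x
    ext φ
    refine and_congr_right fun _ => and_congr_left fun _ => eventually_congr ?_
    filter_upwards [hA'] with s hs
    rw [hs]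
  have hmean : meanOp μ A' = meanOp μ A := by
    funext x
    simp only [meanOp, aumannIntegral, hsel]
  have hzer : zerSel μ A' 2 = zerSel μ A 2 := by
    simp only [zerSel, hsel]
  have hscheme : IsProximalScheme μ P A' lam (fun n => ξ (n + 1)) (iterates A' lam ξ x₀) :=
    { isMax := by
        intro s
        by_cases hs : s ∈ N
        · rw [hA'pos s hs]
          exact isMaximalMonotoneOp_zero
        · rw [hA'neg s hs]
          by_contra hmax
          exact hs (hN hmax)
      meas := by
        intro l hl x
        have : (fun s => resolventMap (A' s) l x) =
            fun s => if s ∈ N then x else resolventMap (A s) l x := by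
          funext s
          by_cases hs : s ∈ N
          · rw [hA'pos s hs, if_pos hs, resolventMap_zero hl]
          · rw [hA'neg s hs, if_neg hs]
        rw [this]
        exact Measurable.ite hNm measurable_const (hA_meas l hl x)
      lam_pos := hlam_pos
      lam_sq := hlam_sq
      noise_meas := fun n => hξ_meas (n + 1) n.succ_pos
      noise_law := fun n => hξ_law (n + 1) n.succ_pos
      noise_indep := hξ_indep
      init := ⟨x₀, fun _ => rfl⟩
      step := fun _ _ => rfl }
  have hmain := hscheme.ae_exists_tendsto hlam_sum (by rwa [hmean]) (by rwa [hmean])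
    (by rwa [hmean, hzer])
  -- Each sample has law μ, so almost surely no sample meets an exceptional s and both operators
  -- generate the same path.
  have hiter : ∀ᵐ ω ∂P, ∀ n, iterates A' lam ξ x₀ n ω = iterates A lam ξ x₀ n ω := by
    have : ∀ᵐ ω ∂P, ∀ n, A' (ξ (n + 1) ω) = A (ξ (n + 1) ω) := ae_all_iff.2 fun n =>
      (hscheme.measurePreserving n).quasiMeasurePreserving.ae hA'
    filter_upwards [this] with ω hω n
    induction n with
    | zero => rfl
    | succ n ih => simp only [iterates, ih, hω]
  filter_upwards [hmain, hiter, hG_UI] with ω hconv heq hUI hωG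
  simp only [heq, hmean] at hconv
  refine hconv (UnifIntegrableFamily.congr_ae (hUI hωG) fun n => ?_)
  filter_upwards [hA'] with s hs
  simp only [hs]
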